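/- Let $n\ge 2$ and write $z=(z_1,z')\in\mathbb C\times\mathbb C^{n-1}$. Let $f:[0,\infty)\to[0,\infty)$ be continuous with $f(0)=0$, $f\not\equiv 0$, and $t\mapsto f(t)/t$ increasing (not necessarily strictly) on $(0,\infty)$; then every $\delta>0$ has exactly one preimage $f^{-1}(\delta)$. Let $D\subset\mathbb C^n$ be a bounded domain with $0\in\partial D$ which near $0$ is given by $\operatorname{Re}z_1+O(|\operatorname{Im}z_1|)<f(\|z'\|)$; that is, there is a real function $h$ with $h(z)=O(|\operatorname{Im}z_1|)$ as $z\to0$ such that, for $z$ in a neighbourhood of $0$, $z\in D$ if and only if $\operatorname{Re}z_1+h(z)<f(\|z'\|)$. For $z\in D$ and $X\in\mathbb C^n$ let $$S_D(z;X)=\sup_v\,[\mathcal L_v(z;X)]^{1/2},$$ where $\mathcal L_v(z;X)=\sum_{j,k}\frac{\partial^2 v}{\partial z_j\partial\bar z_k}(z)X_j\overline{X_k}$ is the Levi form and the supremum is over all $v:D\to[0,1)$ with $v(z)=0$, $\log v$ plurisubharmonic on $D$ (with $\log 0=-\infty$), and $v$ of class $\mathcal C^2$ near $z$ (Sibony metric);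 and let $$A_D(z;X)=\limsup_{\lambda\to0}\frac{\exp g_D(z,z+\lambda X)}{|\lambda|},$$ where $g_D(z,w)=\sup u(w)$, the supremum being over all plurisubharmonic $u:D\to[-\infty,0)$ such that, for some constant $C$, $u(\zeta)<\log\|\zeta-z\|+C$ for all $\zeta\in D\setminus\{z\}$ (Azukawa metric). Then there are constants $c>1$ and $\delta_0>0$ such that for all $\delta\in(0,\delta_0)$ the point $q_\delta:=(-\delta,0')$ belongs to $D$ and, for all $X\in\mathbb C^n$, $$c^{-1}B(\delta;X)\le S_D(q_\delta;X)\le A_D(q_\delta;X)\le c\,B(\delta;X),\qquad B(\delta;X):=\frac{f^{-1}(\delta)}{\delta}|X_1|+\|X\|.$$ -/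

import Mathlib

open Filter Topology MeasureTheory
open scoped NNReal ENNReal

noncomputable section

namespace InvariantMetrics

section PSH

variable {E : Type*} [NormedAddCommGroup E] [NormedSpace ℂ E]

/-- The mean value `(1 / 2π) ∫_0^{2π} u (z + r e^{iθ} X) dθ` of an extended real valued
function `u`, as the difference of the integrals of the positive and of the negative part.
For `u` upper semicontinuous and `< ⊤` the first integral is finite, so that the difference is
never of the form `⊤ - ⊤`. -/
def circleMean (u : E → EReal) (z X : E) (r : ℝ) : EReal :=
  (((2 * Real.pi)⁻¹ : ℝ) : EReal) *
    (((∫⁻ θ in Set.Ioc (0 : ℝ) (2 * Real.pi), (u (z + circleMap 0 r θ • X)).toENNReal : ℝ≥0∞) :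
        EReal) -
      ((∫⁻ θ in Set.Ioc (0 : ℝ) (2 * Real.pi), (-u (z + circleMap 0 r θ • X)).toENNReal : ℝ≥0∞) :
        EReal))

/-- `u : D → [-∞, ∞)` is plurisubharmonic on the open set `D`: it is upper semicontinuous, and
its restriction to every complex line satisfies the local submean value inequality.
The function `u = -∞` is allowed. Only the values of `u` on `D` matter. -/
structure IsPSHOn (u : E → EReal) (D : Set E) : Prop where
  lt_top : ∀ z ∈ D, u z < ⊤
  usc : UpperSemicontinuousOn u D
  submean : ∀ z ∈ D, ∀ X : E, ∀ᶠ r : ℝ in 𝓝[>] 0, u z ≤ circleMean u z X r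

/-- The family of competitors for the pluricomplex Green function of `D` with pole at `z`. At the
pole itself the inequality is to be read in the limit, since there `log ‖w - z‖ = -∞`. -/
structure IsGreenCompetitor (D : Set E) (z : E) (u : E → EReal) : Prop where
  psh : IsPSHOn u D
  neg : ∀ w ∈ D, u w < 0
  pole : ∃ C : ℝ, ∀ w ∈ D, w ≠ z → u w < ((Real.log ‖w - z‖ + C : ℝ) : EReal)

/-- The pluricomplex Green function `g_D(z, w)` of `D` with pole at `z`. -/
def greenFunction (D : Set E) (z w : E) : EReal :=
  ⨆ (u : E → EReal) (_ : IsGreenCompetitor D z u), u w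

/-- The Azukawa metric
`A_D(z; X) = limsup_{λ → 0, λ ≠ 0} exp (g_D(z, z + λ X)) / |λ|`. -/
def azukawaMetric (D : Set E) (z X : E) : ℝ≥0∞ :=
  limsup (fun l : ℂ => (greenFunction D z (z + l • X)).exp / ‖l‖ₑ) (𝓝[≠] (0 : ℂ))

/-- The Levi form `L_v(z; X) = ∑ ∂²v/∂z_j∂z̄_k (z) X_j X̄_k` of a real function `v` that is `C²`
near `z`. It is written as a quarter of the Laplacian at `0` of `λ ↦ v (z + λ X)`, that is,
`(D²v(z)(X, X) + D²v(z)(iX, iX)) / 4`. -/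
def leviForm (v : E → ℝ) (z X : E) : ℝ :=
  (iteratedFDeriv ℝ 2 v z ![X, X] +
    iteratedFDeriv ℝ 2 v z ![Complex.I • X, Complex.I • X]) / 4

/-- The competitors for the Sibony metric of `D` at `z`: functions `v : D → [0, 1)` with
`v z = 0`, of class `C²` near `z`, with `log v` plurisubharmonic on `D` (where `log 0 = -∞`). -/
structure IsSibonyCompetitor (D : Set E) (z : E) (v : E → ℝ) : Prop where
  nonneg : ∀ w ∈ D, 0 ≤ v w
  lt_one : ∀ w ∈ D, v w < 1
  map_base : v z = 0
  log_psh : IsPSHOn (fun w => ENNReal.log (ENNReal.ofReal (v w))) D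
  smooth : ContDiffAt ℝ 2 v z

/-- The Sibony metric `S_D(z; X) = sup_v L_v(z; X)^{1/2}`. -/
def sibonyMetric (D : Set E) (z X : E) : ℝ≥0∞ :=
  ⨆ (v : E → ℝ) (_ : IsSibonyCompetitor D z v), ENNReal.ofReal (Real.sqrt (leviForm v z X))

end PSH

/-- `z' = (z_2, …, z_n)` for `z = (z_1, z') ∈ ℂⁿ`, with `n = m + 1`. -/
def tail {m : ℕ} (z : EuclideanSpace ℂ (Fin (m + 1))) : EuclideanSpace ℂ (Fin m) :=
  WithLp.toLp 2 fun i => z i.succ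

/-- The point `q_δ = (-δ, 0')`. -/
def basePoint (m : ℕ) (δ : ℝ) : EuclideanSpace ℂ (Fin (m + 1)) :=
  EuclideanSpace.single 0 (-(δ : ℂ))

/-- For the profile functions `f` considered here, every `δ > 0` has exactly one preimage, so
that `Function.invFun f δ` is the value `f⁻¹(δ)` of the inverse function. -/
theorem existsUnique_preimage {f : ℝ≥0 → ℝ≥0} (hf : Continuous f) (hf0 : f 0 = 0)
    (hfne : f ≠ 0) (hmono : MonotoneOn (fun t => f t / t) (Set.Ioi 0)) {δ : ℝ≥0} (hδ : 0 < δ) :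
    ∃! t, f t = δ := by
  obtain ⟨a, ha⟩ : ∃ a, f a ≠ 0 := by
    by_contra h
    push Not at h
    exact hfne (funext h)
  have ha0 : 0 < a := by
    rcases eq_or_ne a 0 with h | h
    · exact absurd (h ▸ hf0) ha
    · exact pos_iff_ne_zero.mpr h
  have hfa : 0 < f a / a := div_pos (pos_iff_ne_zero.mpr ha) ha0
  set b := max a (δ / (f a / a)) with hb
  have hb0 : 0 < b := lt_of_lt_of_le ha0 (le_max_left _ _)
  have hδb : δ ≤ f b := by
    have h1 : f a / a ≤ f b / b := hmono ha0 hb0 (le_max_left _ _)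
    have h2 : δ ≤ b * (f a / a) := (div_le_iff₀ hfa).mp (le_max_right _ _)
    calc δ ≤ b * (f a / a) := h2
      _ ≤ b * (f b / b) := by gcongr
      _ = f b := mul_div_cancel₀ _ hb0.ne'
  obtain ⟨t, -, ht⟩ := intermediate_value_Icc (zero_le (a := b)) hf.continuousOn
    (show δ ∈ Set.Icc (f 0) (f b) from ⟨by rw [hf0]; exact zero_le, hδb⟩)
  have key : ∀ s t : ℝ≥0, f s = δ → f t = δ → t ≤ s := by
    intro s t hs ht
    by_contra! hst
    have hs0 : 0 < s := by
      rcases eq_or_ne s 0 with h | h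
      · rw [h, hf0] at hs
        exact absurd hs hδ.ne
      · exact pos_iff_ne_zero.mpr h
    have h := hmono hs0 (hs0.trans hst) hst.le
    simp only [hs, ht] at h
    exact absurd ((div_le_div_iff_of_pos_left hδ hs0 (hs0.trans hst)).mp h) (not_le.mpr hst)
  exact ⟨t, ht, fun s hs => le_antisymm (key t s ht hs) (key s t hs ht)⟩

/-- `B(δ; X) = (f⁻¹(δ) / δ) |X_1| + ‖X‖`. -/
def modelB {m : ℕ} (f : ℝ≥0 → ℝ≥0) (δ : ℝ) (X : EuclideanSpace ℂ (Fin (m + 1))) : ℝ :=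
  ((Function.invFun f δ.toNNReal : ℝ≥0) : ℝ) / δ * ‖X 0‖ + ‖X‖

end InvariantMetrics

end

/-
Let `ν` be the outer normal direction, `δ = f t`, and `q = -δ ν`. The inequality `S ≤ A` holds
because a competitor `v` for the Sibony metric gives the competitor `log v / 2` for the Green
function.

Upper bound for `A`: since `f t / t` increases, `D` contains the discs about `q` of radius
comparable to `1` in those directions whose tangential part dominates `t / δ` times the normal
part. The direction `X` itself need not be one of them, but `X + ζ e` is, for `e` tangential and
`|ζ|` of the size of `R = (t / δ) |X₁| + ‖X‖`, and the maximum principle on `|ζ| ≤ R` transfers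
the estimate to `ζ = 0`.

Lower bound for `S`: the scaled normal coordinate `z₁ / δ` maps the part of `D` where `‖z'‖ < t`
outside a ball around `2`. A Möbius transform of it with pole `2` is therefore bounded on that
part, and it is glued to a power `‖z'‖ ^ (1 + ε)` on the rest of `D`.
-/

noncomputable section

namespace InvariantMetrics

section SubmeanValue

open Metric Set InnerProductSpace

variable {E : Type*} [NormedAddCommGroup E] [NormedSpace ℂ E]

theorem circleMean_mono {u u' : E → EReal} {z X : E} {r : ℝ}
    (h : ∀ θ, u (z + circleMap 0 r θ • X) ≤ u' (z + circleMap 0 r θ • X)) :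
    circleMean u z X r ≤ circleMean u' z X r := by
  unfold circleMean
  refine mul_le_mul_of_nonneg_left (EReal.sub_le_sub ?_ ?_) ?_
  · exact EReal.coe_ennreal_le_coe_ennreal_iff.2
      (lintegral_mono fun θ => EReal.toENNReal_le_toENNReal (h θ))
  · exact EReal.coe_ennreal_le_coe_ennreal_iff.2
      (lintegral_mono fun θ => EReal.toENNReal_le_toENNReal (EReal.neg_le_neg_iff.2 (h θ)))
  · exact EReal.coe_nonneg.2 (by positivity)

theorem circleMean_coe {φ : E → ℝ} {z X : E} {r : ℝ}
    (hφ : Continuous fun θ => φ (z + circleMap 0 r θ • X)) :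
    circleMean (fun w => (φ w : EReal)) z X r =
      ((Real.circleAverage (fun l => φ (z + l • X)) 0 r : ℝ) : EReal) := by
  have hint : IntegrableOn (fun θ => φ (z + circleMap 0 r θ • X)) (Ioc 0 (2 * Real.pi)) :=
    (hφ.integrableOn_Icc).mono_set Ioc_subset_Icc_self
  have hpos : (∫⁻ θ in Ioc (0 : ℝ) (2 * Real.pi),
      ENNReal.ofReal (φ (z + circleMap 0 r θ • X))) ≠ ⊤ := hint.lintegral_lt_top.ne
  have hneg : (∫⁻ θ in Ioc (0 : ℝ) (2 * Real.pi),
      ENNReal.ofReal (-φ (z + circleMap 0 r θ • X))) ≠ ⊤ := hint.neg.lintegral_lt_top.ne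
  unfold circleMean
  simp only [← EReal.coe_neg, EReal.real_coe_toENNReal]
  rw [Real.circleAverage_def, intervalIntegral.integral_of_le (by positivity),
    integral_eq_lintegral_pos_part_sub_lintegral_neg_part hint, smul_eq_mul, EReal.coe_mul,
    EReal.coe_sub]
  congr 2
  · rw [← EReal.coe_ennreal_toReal hpos]
  · rw [← EReal.coe_ennreal_toReal hneg]

theorem circleMean_coe_of_harmonicOnNhd {φ : E → ℝ} {z X : E} {r : ℝ} (hr : 0 ≤ r)
    (h : HarmonicOnNhd (fun l : ℂ => φ (z + l • X)) (closedBall 0 r)) :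
    circleMean (fun w => (φ w : EReal)) z X r = φ z := by
  have hc : ContinuousOn (fun l : ℂ => φ (z + l • X)) (closedBall 0 r) :=
    fun l hl => ((h l hl).1.continuousAt).continuousWithinAt
  rw [circleMean_coe, InnerProductSpace.HarmonicOnNhd.circleAverage_eq (by rwa [abs_of_nonneg hr])]
  · simp
  · exact hc.comp_continuous (continuous_circleMap 0 r)
      fun θ => circleMap_mem_closedBall 0 hr θ

theorem not_eventually_le_harmonic_sub_sq {w : ℂ → EReal} {φ : ℂ → ℝ} {p : ℂ} {η : ℝ}
    (hη : 0 < η) (hφ : HarmonicAt φ p) (hw : ∀ᶠ r : ℝ in 𝓝[>] 0, w p ≤ circleMean w p 1 r)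
    (hp : w p = φ p) : ¬ ∀ᶠ z in 𝓝 p, w z ≤ ((φ z - η * ‖z - p‖ ^ 2 : ℝ) : EReal) := by
  intro hle
  obtain ⟨s, hs, hball⟩ := nhds_basis_ball.eventually_iff.1 (hle.and hφ.eventually)
  obtain ⟨r, hr, hr0, hrs⟩ := (hw.and (Ioo_mem_nhdsGT hs)).exists
  have hsub : closedBall p r ⊆ ball p s := closedBall_subset_ball hrs
  have hmem (θ : ℝ) : p + circleMap 0 r θ ∈ closedBall p r := by
    simp [mem_closedBall, abs_of_pos hr0]
  have hharm : HarmonicOnNhd (fun z => φ z - η * r ^ 2) (closedBall p r) := fun z hz =>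
    (hball (hsub hz)).2.sub (harmonicAt_const _)
  have hmean : circleMean (fun z => ((φ z - η * r ^ 2 : ℝ) : EReal)) p 1 r =
      ((φ p - η * r ^ 2 : ℝ) : EReal) := by
    have hcont : ContinuousOn (fun z => φ z - η * r ^ 2) (closedBall p r) := fun z hz =>
      (hharm z hz).1.continuousAt.continuousWithinAt
    rw [circleMean_coe (φ := fun z => φ z - η * r ^ 2)]
    · simp only [smul_eq_mul, mul_one, add_comm p]
      rw [Real.circleAverage_map_add_const (f := fun z => φ z - η * r ^ 2),
        InnerProductSpace.HarmonicOnNhd.circleAverage_eq (by rwa [abs_of_pos hr0])]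
    · simp only [smul_eq_mul, mul_one]
      exact hcont.comp_continuous (by fun_prop) hmem
  have hle' : w p ≤ ((φ p - η * r ^ 2 : ℝ) : EReal) := by
    refine hr.trans ((circleMean_mono fun θ => ?_).trans hmean.le)
    simpa [abs_of_pos hr0] using (hball (hsub (hmem θ))).1
  rw [hp, EReal.coe_le_coe_iff] at hle'
  linarith [mul_pos hη (pow_pos hr0 2)]

theorem exists_isMaxOn_sub {α : Type*} [TopologicalSpace α] {w : α → EReal} {χ : α → ℝ}
    {K : Set α} (hK : IsCompact K) (husc : UpperSemicontinuousOn w K) (htop : ∀ z ∈ K, w z < ⊤)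
    (hχ : ContinuousOn χ K) {z₀ : α} (hz₀ : z₀ ∈ K) (hbot : w z₀ ≠ ⊥) :
    ∃ p ∈ K, ∃ b : ℝ, w p = b ∧ ∀ z ∈ K, w z ≤ ((b + (χ z - χ p) : ℝ) : EReal) := by
  obtain ⟨p, hp, hmax⟩ := (UpperSemicontinuousOn.add' (g := fun z => ((-χ z : ℝ) : EReal)) husc
      (continuous_coe_real_ereal.comp_continuousOn hχ.neg).upperSemicontinuousOn
      fun z _ => EReal.continuousAt_add (Or.inr (EReal.coe_ne_bot _))
        (Or.inr (EReal.coe_ne_top _))).exists_isMaxOn ⟨z₀, hz₀⟩ hK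
  have hmax : ∀ z ∈ K, w z + ((-χ z : ℝ) : EReal) ≤ w p + ((-χ p : ℝ) : EReal) :=
    fun z hz => hmax hz
  have hpb : w p ≠ ⊥ := by
    intro h
    have := hmax z₀ hz₀
    rw [h, EReal.bot_add, le_bot_iff, EReal.add_eq_bot_iff] at this
    exact this.elim hbot (EReal.coe_ne_bot _)
  lift w p to ℝ using ⟨(htop p hp).ne, hpb⟩ with b hb
  refine ⟨p, hp, b, hb.symm, fun z hz => ?_⟩
  induction hwz : w z with
  | bot => exact bot_le
  | top => exact absurd hwz (htop z hz).ne
  | coe x =>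
    have hz' := hmax z hz
    rw [hwz] at hz'
    norm_cast at hz' ⊢
    linarith

theorem harmonicAt_add_re_mul {φ : ℂ → ℝ} {p : ℂ} (hφ : HarmonicAt φ p) (a : ℝ) (c : ℂ) :
    HarmonicAt (fun z => φ z + (a + (c * (z - p)).re)) p := by
  have h : AnalyticAt ℂ (fun z : ℂ => (a : ℂ) + c * (z - p)) p := by fun_prop
  exact hφ.add (by simpa using h.harmonicAt_re)

theorem IsPSHOn.le_of_le_frontier {w : ℂ → EReal} {Ω K : Set ℂ} (hw : IsPSHOn w Ω)
    (hK : IsCompact K) (hKΩ : K ⊆ Ω) {φ : ℂ → ℝ} (hφ : ContinuousOn φ K)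
    (hharm : ∀ p ∈ interior K, HarmonicAt φ p) (hle : ∀ z ∈ frontier K, w z ≤ φ z) :
    ∀ z ∈ K, w z ≤ φ z := by
  by_contra! hcon
  obtain ⟨z₀, hz₀, hlt⟩ := hcon
  obtain ⟨R, hR⟩ := hK.isBounded.exists_norm_le
  obtain ⟨η, hη, hηR⟩ : ∃ η > 0, ((φ z₀ + η * R ^ 2 : ℝ) : EReal) < w z₀ := by
    have hcont : Tendsto (fun η : ℝ => ((φ z₀ + η * R ^ 2 : ℝ) : EReal)) (𝓝[>] 0)
        (𝓝 (φ z₀ : EReal)) :=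
      ((continuous_coe_real_ereal.comp (by fun_prop)).tendsto' _ _ (by simp)).mono_left
        nhdsWithin_le_nhds
    exact (eventually_mem_nhdsWithin.and (hcont.eventually_lt_const hlt)).exists
  obtain ⟨p, hp, b, hpb, hmax⟩ := exists_isMaxOn_sub (χ := fun z => φ z - η * ‖z‖ ^ 2) hK
    (hw.usc.mono hKΩ) (fun z hz => hw.lt_top z (hKΩ hz)) (by fun_prop) hz₀ (ne_bot_of_gt hlt)
  have hφp : φ p < b := by
    have h := hηR.trans_le (hmax z₀ hz₀)
    rw [EReal.coe_lt_coe_iff] at h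
    have hpR : η * ‖p‖ ^ 2 ≤ η * R ^ 2 := by gcongr; exact hR p hp
    linarith [mul_nonneg hη.le (sq_nonneg ‖z₀‖)]
  have hpK : p ∈ interior K := by
    by_contra hpK
    have h := hle p ⟨subset_closure hp, hpK⟩
    rw [hpb, EReal.coe_le_coe_iff] at h
    linarith
  have hψ := harmonicAt_add_re_mul (hharm p hpK) (b - φ p) (-(2 * η) * starRingEnd ℂ p)
  refine not_eventually_le_harmonic_sub_sq hη hψ (by simpa using hw.submean p (hKΩ hp) 1)
    (by simp [hpb]) ?_
  filter_upwards [mem_interior_iff_mem_nhds.1 hpK] with z hz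
  refine (hmax z hz).trans_eq (congrArg _ ?_)
  have hnorm : ‖z‖ ^ 2 = ‖z - p‖ ^ 2 + ‖p‖ ^ 2 + 2 * (starRingEnd ℂ p * (z - p)).re := by
    simp only [Complex.sq_norm, Complex.normSq_apply, Complex.sub_re, Complex.sub_im,
      Complex.mul_re, Complex.conj_re, Complex.conj_im]
    ring
  rw [hnorm]
  simp [Complex.mul_re]
  ring

theorem IsPSHOn.comp_line {u : E → EReal} {D : Set E} (hu : IsPSHOn u D) (a Y : E) :
    IsPSHOn (fun l : ℂ => u (a + l • Y)) {l | a + l • Y ∈ D} where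
  lt_top l hl := hu.lt_top _ hl
  usc := hu.usc.comp (Continuous.continuousOn (by fun_prop)) fun l hl => hl
  submean l hl X := by
    filter_upwards [hu.submean _ hl (X • Y)] with r hr
    simpa only [circleMean, add_smul, smul_assoc, add_assoc] using hr

end SubmeanValue

section LogHarmonicSupport

open Metric Set InnerProductSpace

variable {E : Type*} [NormedAddCommGroup E] [NormedSpace ℂ E]

/-- `v` is continuous at `z` and, if it is positive there, `log v` is supported at `z` from below
by a function `φ` that is harmonic near `z` along complex lines through `z`. If `v` has this
property at every point, then `log v` is plurisubharmonic; unlike plurisubharmonicity itself,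
the property is evidently inherited by maxima. -/
structure HasLogHarmonicSupportAt (v : E → ℝ) (z : E) : Prop where
  continuousAt : ContinuousAt v z
  exists_support : 0 < v z → ∃ φ : E → ℝ, (∀ X, HarmonicAt (fun l : ℂ => φ (z + l • X)) 0) ∧
    Real.exp (φ z) = v z ∧ ∀ᶠ w in 𝓝 z, Real.exp (φ w) ≤ v w

namespace HasLogHarmonicSupportAt

variable {v v' : E → ℝ} {z : E}

theorem congr (h : HasLogHarmonicSupportAt v z) (heq : v' =ᶠ[𝓝 z] v) :
    HasLogHarmonicSupportAt v' z where
  continuousAt := h.continuousAt.congr heq.symm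
  exists_support hz := by
    rw [heq.eq_of_nhds] at hz ⊢
    obtain ⟨φ, hharm, hφz, hle⟩ := h.exists_support hz
    exact ⟨φ, hharm, hφz, by filter_upwards [hle, heq] with w hw hw' using hw.trans_eq hw'.symm⟩

theorem max (h : HasLogHarmonicSupportAt v z) (h' : HasLogHarmonicSupportAt v' z) :
    HasLogHarmonicSupportAt (fun w => max (v w) (v' w)) z where
  continuousAt := h.continuousAt.max h'.continuousAt
  exists_support hz := by
    rcases le_total (v z) (v' z) with hle | hle
    · rw [max_eq_right hle] at hz ⊢
      obtain ⟨φ, hharm, hφz, hφ⟩ := h'.exists_support hz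
      exact ⟨φ, hharm, hφz, hφ.mono fun w hw => le_max_of_le_right hw⟩
    · rw [max_eq_left hle] at hz ⊢
      obtain ⟨φ, hharm, hφz, hφ⟩ := h.exists_support hz
      exact ⟨φ, hharm, hφz, hφ.mono fun w hw => le_max_of_le_left hw⟩

theorem const_mul (h : HasLogHarmonicSupportAt v z) {a : ℝ} (ha : 0 ≤ a) :
    HasLogHarmonicSupportAt (fun w => a * v w) z where
  continuousAt := h.continuousAt.const_mul a
  exists_support hz := by
    obtain ⟨φ, hharm, hφz, hφ⟩ := h.exists_support (pos_of_mul_pos_right hz ha)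
    have ha' : 0 < a := pos_of_mul_pos_left hz (hφz ▸ (Real.exp_pos _).le)
    refine ⟨fun w => Real.log a + φ w, fun X => (harmonicAt_const _).add (hharm X), ?_,
      hφ.mono fun w hw => ?_⟩ <;> rw [Real.exp_add, Real.exp_log ha']
    · rw [hφz]
    · gcongr

theorem sq (h : HasLogHarmonicSupportAt v z) (hz : 0 ≤ v z) :
    HasLogHarmonicSupportAt (fun w => v w ^ 2) z where
  continuousAt := h.continuousAt.pow 2
  exists_support hz' := by
    obtain ⟨φ, hharm, hφz, hφ⟩ := h.exists_support
      (hz.lt_of_ne' fun h0 => by simp [h0] at hz')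
    refine ⟨fun w => φ w + φ w, fun X => (hharm X).add (hharm X), ?_,
      hφ.mono fun w hw => ?_⟩ <;> rw [Real.exp_add, ← pow_two]
    · rw [hφz]
    · gcongr

end HasLogHarmonicSupportAt

theorem hasLogHarmonicSupportAt_norm_rpow {H : Type*} [NormedAddCommGroup H]
    [InnerProductSpace ℂ H] {G : E → H} {z : E} (hG : ∀ᶠ w in 𝓝 z, DifferentiableAt ℂ G w)
    {a : ℝ} (ha : 0 < a) : HasLogHarmonicSupportAt (fun w => ‖G w‖ ^ a) z where
  continuousAt := hG.self_of_nhds.continuousAt.norm.rpow_const (Or.inr ha.le)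
  exists_support hz := by
    have hn : 0 < ‖G z‖ := (norm_nonneg _).lt_of_ne' fun h0 => by
      simp [h0, Real.zero_rpow ha.ne'] at hz
    have hGz : inner ℂ (G z) (G z) ≠ 0 := inner_self_ne_zero.2 (norm_pos_iff.1 hn)
    have hself : ‖inner ℂ (G z) (G z)‖ = ‖G z‖ * ‖G z‖ := by
      simp [inner_self_eq_norm_sq_to_K, pow_two]
    have hne : ∀ᶠ w in 𝓝 z, inner ℂ (G z) (G w) ≠ 0 :=
      (ContinuousAt.inner continuousAt_const hG.self_of_nhds.continuousAt).eventually_ne hGz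
    have hexp {w : E} (hw : inner ℂ (G z) (G w) ≠ 0) :
        Real.exp (a * (Real.log ‖inner ℂ (G z) (G w)‖ - Real.log ‖G z‖)) =
          (‖inner ℂ (G z) (G w)‖ / ‖G z‖) ^ a := by
      rw [← Real.log_div (norm_ne_zero_iff.2 hw) hn.ne', mul_comm,
        Real.rpow_def_of_pos (div_pos (norm_pos_iff.2 hw) hn)]
    refine ⟨fun w => a * (Real.log ‖inner ℂ (G z) (G w)‖ - Real.log ‖G z‖), fun X => ?_, ?_,
      hne.mono fun w hw => ?_⟩
    · have hline : Tendsto (fun l : ℂ => z + l • X) (𝓝 0) (𝓝 z) :=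
        Continuous.tendsto' (by fun_prop) _ _ (by simp)
      have hanal : AnalyticAt ℂ (fun l : ℂ => inner ℂ (G z) (G (z + l • X))) 0 :=
        Complex.analyticAt_iff_eventually_differentiableAt.2 <|
          (hline.eventually hG).mono fun l hl =>
            (innerSL ℂ (G z)).differentiableAt.comp l (hl.comp l (by fun_prop))
      exact ((hanal.harmonicAt_log_norm (by simpa using norm_pos_iff.1 hn)).sub
        (harmonicAt_const (Real.log ‖G z‖))).const_smul (c := a)
    · rw [hexp hGz, hself, mul_div_cancel_right₀ _ hn.ne']
    · rw [hexp hw]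
      gcongr
      rw [div_le_iff₀ hn, mul_comm]
      exact norm_inner_le_norm _ _

theorem isPSHOn_log_of_hasLogHarmonicSupportAt {v : E → ℝ} {D : Set E}
    (hv : ∀ z ∈ D, HasLogHarmonicSupportAt v z) :
    IsPSHOn (fun w => ENNReal.log (ENNReal.ofReal (v w))) D where
  lt_top z _ := ENNReal.log_lt_top_iff.2 ENNReal.ofReal_lt_top
  usc := (ENNReal.continuous_log.comp_continuousOn (ENNReal.continuous_ofReal.comp_continuousOn
    fun z hz => (hv z hz).continuousAt.continuousWithinAt)).upperSemicontinuousOn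
  submean z hz X := by
    rcases le_or_gt (v z) 0 with hvz | hvz
    · exact Eventually.of_forall fun r => by simp [ENNReal.ofReal_of_nonpos hvz]
    obtain ⟨φ, hharm, hφz, hφ⟩ := (hv z hz).exists_support hvz
    have hlog (x : ℝ) : (x : EReal) = ENNReal.log (ENNReal.ofReal (Real.exp x)) := by
      rw [ENNReal.log_ofReal_of_pos (Real.exp_pos _), Real.log_exp]
    have hline : Tendsto (fun l : ℂ => z + l • X) (𝓝 0) (𝓝 z) :=
      Continuous.tendsto' (by fun_prop) _ _ (by simp)
    obtain ⟨s, hs, hball⟩ := nhds_basis_ball.eventually_iff.1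
      ((hharm X).eventually.and (hline.eventually hφ))
    filter_upwards [Ioo_mem_nhdsGT hs] with r hr
    have hsub : closedBall (0 : ℂ) r ⊆ ball 0 s := closedBall_subset_ball hr.2
    calc ENNReal.log (ENNReal.ofReal (v z)) = φ z := by rw [hlog, hφz]
      _ = circleMean (fun w => (φ w : EReal)) z X r :=
        (circleMean_coe_of_harmonicOnNhd hr.1.le fun l hl => (hball (hsub hl)).1).symm
      _ ≤ _ := circleMean_mono fun θ => by
        rw [hlog]
        exact ENNReal.log_monotone (ENNReal.ofReal_le_ofReal
          (hball (hsub (circleMap_mem_closedBall 0 hr.1.le θ))).2)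

end LogHarmonicSupport

section Taylor

open Metric Asymptotics

variable {E F : Type*} [NormedAddCommGroup E] [NormedSpace ℝ E] [NormedAddCommGroup F]
  [NormedSpace ℝ F]

theorem isLittleO_sub_of_isLittleO_fderiv {g : E → F} {g' : E → E →L[ℝ] F} {z : E}
    (hg : ∀ᶠ x in 𝓝 z, HasFDerivAt g (g' x) x) (hg' : g' =o[𝓝 z] fun x => x - z) :
    (fun x => g x - g z) =o[𝓝 z] fun x => ‖x - z‖ ^ 2 := by
  refine isLittleO_iff.2 fun ε hε => ?_
  obtain ⟨s, hs, hball⟩ := nhds_basis_ball.eventually_iff.1 (hg.and (isLittleO_iff.1 hg' hε))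
  filter_upwards [ball_mem_nhds z hs] with w hw
  have hsub : closedBall z ‖w - z‖ ⊆ ball z s :=
    closedBall_subset_ball (by simpa [dist_eq_norm] using hw)
  have hmean := (convex_closedBall z ‖w - z‖).norm_image_sub_le_of_norm_hasFDerivWithin_le
    (fun x hx => (hball (hsub hx)).1.hasFDerivWithinAt)
    (fun x hx => (hball (hsub hx)).2.trans
      (mul_le_mul_of_nonneg_left (mem_closedBall_iff_norm.1 hx) hε.le))
    (mem_closedBall_self (norm_nonneg _)) (mem_closedBall_iff_norm.2 le_rfl)
  calc ‖g w - g z‖ ≤ ε * ‖w - z‖ * ‖w - z‖ := hmean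
    _ = ε * ‖‖w - z‖ ^ 2‖ := by simp [pow_two, mul_assoc]

theorem isLittleO_sub_taylor_two {v : E → F} {z : E} (hv : ContDiffAt ℝ 2 v z) :
    (fun w => v w - v z - fderiv ℝ v z (w - z) -
      (2⁻¹ : ℝ) • iteratedFDeriv ℝ 2 v z ![w - z, w - z]) =o[𝓝 z] fun w => ‖w - z‖ ^ 2 := by
  set B := fderiv ℝ (fderiv ℝ v) z
  have hsymm (x y : E) : B x y = B y x :=
    hv.isSymmSndFDerivAt (by simp) x y
  have hd : ∀ᶠ w in 𝓝 z, DifferentiableAt ℝ v w :=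
    (hv.eventually (by simp)).mono fun w hw => hw.differentiableAt two_ne_zero
  have hd2 : HasFDerivAt (fderiv ℝ v) B z :=
    ((hv.fderiv_right (m := 1) le_rfl).differentiableAt one_ne_zero).hasFDerivAt
  have hquad (w : E) : HasFDerivAt (fun w => (2⁻¹ : ℝ) • B (w - z) (w - z)) (B (w - z)) w := by
    have hsub : HasFDerivAt (fun w => w - z) (.id ℝ E) w := (hasFDerivAt_id w).sub_const z
    refine (((B.hasFDerivAt.comp w hsub).clm_apply hsub).const_smul (2⁻¹ : ℝ)).congr_fderiv ?_
    ext y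
    simp [hsymm y, ← two_smul ℝ, smul_smul]
  have hg : ∀ᶠ w in 𝓝 z, HasFDerivAt
      (fun w => v w - fderiv ℝ v z (w - z) - (2⁻¹ : ℝ) • B (w - z) (w - z))
      (fderiv ℝ v w - fderiv ℝ v z - B (w - z)) w := hd.mono fun w hw =>
    (hw.hasFDerivAt.sub ((fderiv ℝ v z).hasFDerivAt.comp w
      ((hasFDerivAt_id w).sub_const z))).sub (hquad w)
  refine (isLittleO_sub_of_isLittleO_fderiv hg hd2.isLittleO).congr_left fun w => ?_
  simp [iteratedFDeriv_two_apply, B]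
  abel

end Taylor

section LeviForm

open Metric Set Asymptotics

variable {E : Type*} [NormedAddCommGroup E] [NormedSpace ℂ E]

theorem isLittleO_sub_iteratedFDeriv_two {v : E → ℝ} {z : E} (hv : ContDiffAt ℝ 2 v z)
    (hmin : IsLocalMin v z) (hz : v z = 0) :
    (fun w => v w - 2⁻¹ * iteratedFDeriv ℝ 2 v z ![w - z, w - z]) =o[𝓝 z]
      fun w => ‖w - z‖ ^ 2 := by
  simpa [hmin.fderiv_eq_zero, hz] using isLittleO_sub_taylor_two hv

theorem isBigO_norm_sub_sq {v : E → ℝ} {z : E} (hv : ContDiffAt ℝ 2 v z)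
    (hmin : IsLocalMin v z) (hz : v z = 0) : v =O[𝓝 z] fun w => ‖w - z‖ ^ 2 := by
  have hquad : (fun w => 2⁻¹ * iteratedFDeriv ℝ 2 v z ![w - z, w - z]) =O[𝓝 z]
      fun w => ‖w - z‖ ^ 2 := by
    refine (IsBigO.of_bound ‖iteratedFDeriv ℝ 2 v z‖
      (Eventually.of_forall fun w => ?_)).const_mul_left _
    simpa [Fin.prod_univ_two, pow_two] using
      (iteratedFDeriv ℝ 2 v z).le_opNorm ![w - z, w - z]
  simpa using (isLittleO_sub_iteratedFDeriv_two hv hmin hz).isBigO.add hquad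

theorem tendsto_div_sq {v : E → ℝ} {z : E} (hv : ContDiffAt ℝ 2 v z)
    (hmin : IsLocalMin v z) (hz : v z = 0) (X : E) :
    Tendsto (fun r : ℝ => v (z + r • X) / r ^ 2) (𝓝[≠] 0)
      (𝓝 (2⁻¹ * iteratedFDeriv ℝ 2 v z ![X, X])) := by
  have hline : Tendsto (fun r : ℝ => z + r • X) (𝓝[≠] 0) (𝓝 z) :=
    (Continuous.tendsto' (by fun_prop) _ _ (by simp)).mono_left nhdsWithin_le_nhds
  have hlittle : (fun r : ℝ => v (z + r • X) - 2⁻¹ * iteratedFDeriv ℝ 2 v z ![X, X] * r ^ 2)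
      =o[𝓝[≠] 0] fun r : ℝ => r ^ 2 := by
    refine (((isLittleO_sub_iteratedFDeriv_two hv hmin hz).comp_tendsto hline).congr_left
      fun r => ?_).trans_isBigO (IsBigO.of_bound (‖X‖ ^ 2) (Eventually.of_forall fun r => ?_))
    · simp [iteratedFDeriv_two_apply]
      ring
    · simp [norm_smul, mul_pow, mul_comm]
  rw [← tendsto_sub_nhds_zero_iff]
  refine hlittle.tendsto_div_nhds_zero.congr' ?_
  filter_upwards [self_mem_nhdsWithin] with r hr
  have hr0 : r ≠ 0 := hr
  field_simp

theorem tendsto_leviForm {v : E → ℝ} {z : E} (hv : ContDiffAt ℝ 2 v z)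
    (hmin : IsLocalMin v z) (hz : v z = 0) (X : E) :
    Tendsto (fun r : ℝ =>
        (v (z + (r : ℂ) • X) / r ^ 2 + v (z + (r * Complex.I : ℂ) • X) / r ^ 2) / 2)
      (𝓝[≠] 0) (𝓝 (leviForm v z X)) := by
  convert ((tendsto_div_sq hv hmin hz X).add
    (tendsto_div_sq hv hmin hz (Complex.I • X))).div_const 2 using 2
  · simp only [mul_smul, Complex.coe_smul]
  · rw [leviForm]
    ring

theorem tendsto_ofReal_mul_nhdsNE_zero {c : ℂ} (hc : c ≠ 0) :
    Tendsto (fun r : ℝ => (r : ℂ) * c) (𝓝[≠] 0) (𝓝[≠] 0) := by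
  refine tendsto_nhdsWithin_iff.2 ⟨?_, ?_⟩
  · exact (Continuous.tendsto' (by fun_prop) _ _ (by simp)).mono_left nhdsWithin_le_nhds
  · filter_upwards [self_mem_nhdsWithin] with r hr
    simpa [hc] using hr

theorem le_leviForm {v : E → ℝ} {z X : E} {a : ℝ} (hv : ContDiffAt ℝ 2 v z)
    (hmin : IsLocalMin v z) (hz : v z = 0)
    (ha : ∀ᶠ l : ℂ in 𝓝[≠] 0, a * ‖l‖ ^ 2 ≤ v (z + l • X)) : a ≤ leviForm v z X := by
  refine ge_of_tendsto (tendsto_leviForm hv hmin hz X) ?_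
  filter_upwards [(tendsto_ofReal_mul_nhdsNE_zero one_ne_zero).eventually ha,
    (tendsto_ofReal_mul_nhdsNE_zero Complex.I_ne_zero).eventually ha, self_mem_nhdsWithin]
    with r h1 hI hr
  have hr2 : 0 < r ^ 2 := sq_pos_of_ne_zero hr
  simp only [mul_one, norm_mul, Complex.norm_real, Complex.norm_I, Real.norm_eq_abs,
    sq_abs] at h1 hI
  linarith [(le_div_iff₀ hr2).2 h1, (le_div_iff₀ hr2).2 hI]

theorem leviForm_le {v : E → ℝ} {z X : E} {a : ℝ} (hv : ContDiffAt ℝ 2 v z)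
    (hmin : IsLocalMin v z) (hz : v z = 0)
    (ha : ∀ᶠ l : ℂ in 𝓝[≠] 0, v (z + l • X) ≤ a * ‖l‖ ^ 2) : leviForm v z X ≤ a := by
  refine le_of_tendsto (tendsto_leviForm hv hmin hz X) ?_
  filter_upwards [(tendsto_ofReal_mul_nhdsNE_zero one_ne_zero).eventually ha,
    (tendsto_ofReal_mul_nhdsNE_zero Complex.I_ne_zero).eventually ha, self_mem_nhdsWithin]
    with r h1 hI hr
  have hr2 : 0 < r ^ 2 := sq_pos_of_ne_zero hr
  simp only [mul_one, norm_mul, Complex.norm_real, Complex.norm_I, Real.norm_eq_abs,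
    sq_abs] at h1 hI
  linarith [(div_le_iff₀ hr2).2 h1, (div_le_iff₀ hr2).2 hI]

end LeviForm

section SibonyAzukawa

open Metric Set Asymptotics

variable {E : Type*} [NormedAddCommGroup E] [NormedSpace ℂ E]

theorem IsPSHOn.const_mul {u : E → EReal} {D : Set E} (hu : IsPSHOn u D) {c : ℝ} (hc : 0 < c) :
    IsPSHOn (fun w => (c : EReal) * u w) D where
  lt_top z hz := by
    have h := hu.lt_top z hz
    induction hx : u z with
    | bot => rw [EReal.coe_mul_bot_of_pos hc]; exact bot_lt_top
    | coe x => rw [← EReal.coe_mul]; exact EReal.coe_lt_top _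
    | top => exact absurd hx h.ne
  usc :=
    have hcont : Continuous fun x : EReal => (c : EReal) * x :=
      continuous_iff_continuousAt.2 fun x =>
        EReal.Tendsto.const_mul tendsto_id (by simp) (by simp)
    hcont.comp_upperSemicontinuousOn hu.usc
      fun a b hab => mul_le_mul_of_nonneg_left hab (EReal.coe_nonneg.2 hc.le)
  submean z hz X := by
    filter_upwards [hu.submean z hz X] with r hr
    have hc' : (0 : EReal) ≤ c := EReal.coe_nonneg.2 hc.le
    refine (mul_le_mul_of_nonneg_left hr hc').trans (le_of_eq ?_)
    unfold circleMean
    simp only [← _root_.mul_neg, EReal.toENNReal_mul hc', EReal.real_coe_toENNReal]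
    rw [lintegral_const_mul' _ _ ENNReal.ofReal_ne_top,
      lintegral_const_mul' _ _ ENNReal.ofReal_ne_top, EReal.coe_ennreal_mul,
      EReal.coe_ennreal_mul, EReal.coe_ennreal_ofReal, max_eq_left hc.le,
      mul_left_comm, EReal.mul_sub_of_nonneg_of_ne_top hc' (EReal.coe_ne_top c)]

namespace IsSibonyCompetitor

variable {D : Set E} {z : E} {v : E → ℝ}

theorem isLocalMin (hv : IsSibonyCompetitor D z v) (hD : D ∈ 𝓝 z) : IsLocalMin v z :=
  mem_of_superset hD fun w hw => hv.map_base.trans_le (hv.nonneg w hw)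

theorem isPSHOn_log_sqrt (hv : IsSibonyCompetitor D z v) :
    IsPSHOn (fun w => ENNReal.log (ENNReal.ofReal (√(v w)))) D := by
  convert hv.log_psh.const_mul (c := 1 / 2) (by norm_num) using 2 with w
  rw [← ENNReal.log_rpow]
  congr 1
  rcases le_total (v w) 0 with h | h
  · simp [Real.sqrt_eq_zero_of_nonpos h, ENNReal.ofReal_of_nonpos h]
  · rw [Real.sqrt_eq_rpow, ENNReal.ofReal_rpow_of_nonneg h (by norm_num)]

theorem exists_sqrt_le_mul_norm (hv : IsSibonyCompetitor D z v) (hD : D ∈ 𝓝 z) :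
    ∃ M > 0, ∀ w ∈ D, w ≠ z → √(v w) < M * ‖w - z‖ := by
  obtain ⟨K, hK0, hK⟩ :=
    (isBigO_norm_sub_sq hv.smooth (hv.isLocalMin hD) hv.map_base).exists_pos
  obtain ⟨s, hs, hball⟩ := nhds_basis_ball.eventually_iff.1 hK.bound
  refine ⟨√K + s⁻¹ + 1, by positivity, fun w hw hwz => ?_⟩
  have hn : 0 < ‖w - z‖ := norm_pos_iff.2 (sub_ne_zero.2 hwz)
  have hle : √(v w) ≤ (√K + s⁻¹) * ‖w - z‖ := by
    rw [add_mul]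
    by_cases hws : w ∈ ball z s
    · have hvw : v w ≤ K * ‖w - z‖ ^ 2 := by simpa using (le_abs_self _).trans (hball hws)
      have hsqrt : √(v w) ≤ √K * ‖w - z‖ := by
        simpa [hK0.le] using Real.sqrt_le_sqrt hvw
      exact hsqrt.trans (le_add_of_nonneg_right (by positivity))
    · have hsw : s ≤ ‖w - z‖ := by simpa [dist_eq_norm] using hws
      have hone : 1 ≤ s⁻¹ * ‖w - z‖ := by rwa [inv_mul_eq_div, one_le_div hs]
      have hsqrt : √(v w) ≤ 1 := Real.sqrt_le_one.2 (hv.lt_one w hw).le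
      exact (hsqrt.trans hone).trans (le_add_of_nonneg_left (by positivity))
  linarith

theorem isGreenCompetitor (hv : IsSibonyCompetitor D z v) (hD : D ∈ 𝓝 z) :
    IsGreenCompetitor D z fun w => ENNReal.log (ENNReal.ofReal (√(v w))) where
  psh := hv.isPSHOn_log_sqrt
  neg w hw := by
    rw [ENNReal.log_lt_zero_iff, ENNReal.ofReal_lt_one, Real.sqrt_lt' one_pos, one_pow]
    exact hv.lt_one w hw
  pole := by
    obtain ⟨M, hM, hle⟩ := hv.exists_sqrt_le_mul_norm hD
    refine ⟨Real.log M, fun w hw hwz => ?_⟩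
    have hn : 0 < ‖w - z‖ := norm_pos_iff.2 (sub_ne_zero.2 hwz)
    rw [add_comm, ← Real.log_mul hM.ne' hn.ne', ← ENNReal.log_ofReal_of_pos (by positivity),
      ENNReal.log_lt_log_iff, ENNReal.ofReal_lt_ofReal_iff (by positivity)]
    exact hle w hw hwz

theorem ofReal_sqrt_le_exp_greenFunction (hv : IsSibonyCompetitor D z v) (hD : D ∈ 𝓝 z) (w : E) :
    ENNReal.ofReal (√(v w)) ≤ (greenFunction D z w).exp := by
  have hle : ENNReal.log (ENNReal.ofReal (√(v w))) ≤ greenFunction D z w :=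
    le_iSup₂ (f := fun (u : E → EReal) (_ : IsGreenCompetitor D z u) => u w) _
      (hv.isGreenCompetitor hD)
  simpa only [ENNReal.exp_log] using EReal.exp_monotone hle

theorem ofReal_le_sibonyMetric (hv : IsSibonyCompetitor D z v) (hD : D ∈ 𝓝 z) {X : E} {k : ℝ}
    (hk : ∀ᶠ l : ℂ in 𝓝[≠] 0, (k * ‖l‖) ^ 2 ≤ v (z + l • X)) :
    ENNReal.ofReal k ≤ sibonyMetric D z X := by
  have hlevi : k ^ 2 ≤ leviForm v z X :=
    le_leviForm hv.smooth (hv.isLocalMin hD) hv.map_base (by simpa only [mul_pow] using hk)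
  exact (ENNReal.ofReal_le_ofReal (Real.le_sqrt_of_sq_le hlevi)).trans
    (le_iSup₂ (f := fun (v : E → ℝ) (_ : IsSibonyCompetitor D z v) =>
      ENNReal.ofReal (√(leviForm v z X))) v hv)

end IsSibonyCompetitor

theorem sibonyMetric_le_azukawaMetric {D : Set E} {z : E} (hD : D ∈ 𝓝 z) (X : E) :
    sibonyMetric D z X ≤ azukawaMetric D z X := by
  refine iSup₂_le fun v hv => le_of_forall_gt_imp_ge_of_dense fun a ha => ?_
  rcases eq_or_ne a ⊤ with rfl | ha_top
  · exact le_top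
  lift a to ℝ≥0 using ha_top
  rw [← ENNReal.ofReal_coe_nnreal]
  refine ENNReal.ofReal_le_ofReal (Real.sqrt_le_iff.2 ⟨a.2, ?_⟩)
  refine leviForm_le hv.smooth (hv.isLocalMin hD) hv.map_base ?_
  filter_upwards [eventually_lt_of_limsup_lt ha, self_mem_nhdsWithin] with l hl hl0
  have hsqrt : √(v (z + l • X)) ≤ a * ‖l‖ := by
    rw [← ENNReal.ofReal_le_ofReal_iff (by positivity), ENNReal.ofReal_mul a.coe_nonneg,
      ENNReal.ofReal_coe_nnreal, ofReal_norm]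
    exact (hv.ofReal_sqrt_le_exp_greenFunction hD _).trans
      ((ENNReal.div_le_iff_le_mul (by simp [mem_compl_singleton_iff.1 hl0]) (by simp)).1 hl.le)
  rw [← mul_pow]
  exact (Real.sqrt_le_left (by positivity)).1 hsqrt

end SibonyAzukawa

section AzukawaDiscs

open Metric Set InnerProductSpace

theorem IsPSHOn.le_one_sub_mul_log {w : ℂ → EReal} {Ω : Set ℂ} (hw : IsPSHOn w Ω) {ρ C η : ℝ}
    (hΩ : closedBall 0 ρ ⊆ Ω) (hle : ∀ l ∈ closedBall 0 ρ, w l ≤ 0)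
    (hpole : ∀ l ∈ closedBall 0 ρ, l ≠ 0 → w l ≤ ((Real.log ‖l‖ + C : ℝ) : EReal))
    (hη : 0 < η) {l : ℂ} (hl0 : l ≠ 0) (hl : l ∈ closedBall 0 ρ) :
    w l ≤ (((1 - η) * (Real.log ‖l‖ - Real.log ρ) : ℝ) : EReal) := by
  obtain ⟨σ, hσ, hσl, hlogσ⟩ : ∃ σ > 0, σ ≤ ‖l‖ ∧
      Real.log σ + C ≤ (1 - η) * (Real.log σ - Real.log ρ) := by
    have hσ : 0 < min ‖l‖ (Real.exp ((-C - (1 - η) * Real.log ρ) / η)) :=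
      lt_min (norm_pos_iff.2 hl0) (Real.exp_pos _)
    refine ⟨_, hσ, min_le_left _ _, ?_⟩
    have hlog := (Real.log_le_iff_le_exp hσ).2 (min_le_right ‖l‖ _)
    rw [le_div_iff₀ hη] at hlog
    linarith
  set K : Set ℂ := norm ⁻¹' Icc σ ρ
  have hKball : K ⊆ closedBall 0 ρ := fun x hx => mem_closedBall_zero_iff.2 hx.2
  have hK : IsCompact K :=
    (isCompact_closedBall 0 ρ).of_isClosed_subset (isClosed_Icc.preimage continuous_norm) hKball
  have hK0 : ∀ x ∈ K, x ≠ 0 := fun x hx => norm_pos_iff.1 (hσ.trans_le hx.1)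
  have hfrontier : ∀ x ∈ frontier K, ‖x‖ = σ ∨ ‖x‖ = ρ := fun x hx => by
    simpa [frontier_Icc (hσl.trans (mem_closedBall_zero_iff.1 hl))] using
      continuous_norm.frontier_preimage_subset _ hx
  refine hw.le_of_le_frontier hK (hKball.trans hΩ)
    (φ := fun x => (1 - η) * (Real.log ‖x‖ - Real.log ρ)) ?_ (fun p hp => ?_) (fun x hx => ?_) l
    ⟨hσl, mem_closedBall_zero_iff.1 hl⟩
  · exact ((continuous_norm.continuousOn.log fun x hx => norm_ne_zero_iff.2 (hK0 x hx)).sub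
      continuousOn_const).const_smul (1 - η)
  · exact ((analyticAt_id.harmonicAt_log_norm (hK0 p (interior_subset hp))).sub
      (harmonicAt_const (Real.log ρ))).const_smul (c := 1 - η)
  · have hxK : x ∈ K := hK.isClosed.frontier_subset hx
    rcases hfrontier x hx with h | h
    · refine (hpole x (hKball hxK) (hK0 x hxK)).trans ?_
      rwa [EReal.coe_le_coe_iff, h]
    · simpa [h] using hle x (hKball hxK)

theorem IsPSHOn.le_log_sub_log {w : ℂ → EReal} {Ω : Set ℂ} (hw : IsPSHOn w Ω) {ρ C : ℝ}
    (hΩ : closedBall 0 ρ ⊆ Ω) (hle : ∀ l ∈ closedBall 0 ρ, w l ≤ 0)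
    (hpole : ∀ l ∈ closedBall 0 ρ, l ≠ 0 → w l ≤ ((Real.log ‖l‖ + C : ℝ) : EReal))
    {l : ℂ} (hl0 : l ≠ 0) (hl : l ∈ closedBall 0 ρ) :
    w l ≤ ((Real.log ‖l‖ - Real.log ρ : ℝ) : EReal) := by
  have hlim : Tendsto (fun η : ℝ => (((1 - η) * (Real.log ‖l‖ - Real.log ρ) : ℝ) : EReal))
      (𝓝[>] 0) (𝓝 ((Real.log ‖l‖ - Real.log ρ : ℝ) : EReal)) :=
    ((continuous_coe_real_ereal.comp (by fun_prop)).tendsto' _ _ (by simp)).mono_left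
      nhdsWithin_le_nhds
  exact ge_of_tendsto hlim <| eventually_mem_nhdsWithin.mono fun η hη =>
    hw.le_one_sub_mul_log hΩ hle hpole hη hl0 hl

variable {E : Type*} [NormedAddCommGroup E] [NormedSpace ℂ E]

theorem IsGreenCompetitor.le_log_sub_log {D : Set E} {q Y : E} {u : E → EReal}
    (hu : IsGreenCompetitor D q u) {ρ : ℝ} (hY : Y ≠ 0)
    (hdisc : ∀ l ∈ closedBall (0 : ℂ) ρ, q + l • Y ∈ D) {l : ℂ} (hl0 : l ≠ 0)
    (hl : l ∈ closedBall 0 ρ) :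
    u (q + l • Y) ≤ ((Real.log ‖l‖ - Real.log ρ : ℝ) : EReal) := by
  obtain ⟨C, hC⟩ := hu.pole
  refine (hu.psh.comp_line q Y).le_log_sub_log (C := Real.log ‖Y‖ + C) hdisc
    (fun x hx => (hu.neg _ (hdisc x hx)).le) (fun x hx hx0 => ?_) hl0 hl
  refine (hC _ (hdisc x hx) (by simp [hx0, hY])).le.trans_eq (congrArg _ ?_)
  rw [add_sub_cancel_left, norm_smul,
    Real.log_mul (norm_ne_zero_iff.2 hx0) (norm_ne_zero_iff.2 hY), add_assoc]

-- Only the discs in the directions `X + ζ • e` with `‖ζ‖ = R` need lie in `D`: the comparison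
-- principle on `ζ ↦ q + l • (X + ζ • e)` propagates the bound to `ζ = 0`, whose own disc may
-- leave `D`.
theorem greenFunction_le_of_discs {D : Set E} {q X e : E} {R s : ℝ} (hR : 0 ≤ R)
    (hne : ∀ ζ ∈ sphere (0 : ℂ) R, X + ζ • e ≠ 0)
    (hdisc : ∀ ζ ∈ sphere (0 : ℂ) R, ∀ l ∈ closedBall (0 : ℂ) s, q + l • (X + ζ • e) ∈ D)
    {l : ℂ} (hl0 : l ≠ 0) (hls : l ∈ closedBall 0 s)
    (hmem : ∀ ζ ∈ closedBall (0 : ℂ) R, q + l • (X + ζ • e) ∈ D) :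
    greenFunction D q (q + l • X) ≤ ((Real.log ‖l‖ - Real.log s : ℝ) : EReal) := by
  refine iSup₂_le fun u hu => ?_
  have hsplit (ζ : ℂ) : q + l • X + ζ • l • e = q + l • (X + ζ • e) := by
    rw [smul_add, smul_comm ζ, add_assoc]
  have hline := hu.psh.comp_line (q + l • X) (l • e)
  simp only [hsplit] at hline
  simpa using hline.le_of_le_frontier (φ := fun _ => Real.log ‖l‖ - Real.log s)
    (isCompact_closedBall 0 R) hmem continuousOn_const (fun p _ => harmonicAt_const _)
    (fun ζ hζ => hu.le_log_sub_log (hne ζ (frontier_closedBall_subset_sphere hζ))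
      (hdisc ζ (frontier_closedBall_subset_sphere hζ)) hl0 hls) 0 (mem_closedBall_self hR)

theorem azukawaMetric_le_of_discs {D : Set E} {q X e : E} (hD : D ∈ 𝓝 q) {R s : ℝ}
    (hR : 0 ≤ R) (hs : 0 < s) (hne : ∀ ζ ∈ sphere (0 : ℂ) R, X + ζ • e ≠ 0)
    (hdisc : ∀ ζ ∈ sphere (0 : ℂ) R, ∀ l ∈ closedBall (0 : ℂ) s, q + l • (X + ζ • e) ∈ D) :
    azukawaMetric D q X ≤ ENNReal.ofReal s⁻¹ := by
  have hmem : ∀ᶠ l : ℂ in 𝓝 0, ∀ ζ ∈ closedBall (0 : ℂ) R, q + l • (X + ζ • e) ∈ D := by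
    refine (isCompact_closedBall 0 R).eventually_forall_of_forall_eventually fun ζ _ => ?_
    have hcont : Tendsto (fun x : ℂ × ℂ => q + x.1 • (X + x.2 • e)) (𝓝 (0, ζ)) (𝓝 q) :=
      Continuous.tendsto' (by fun_prop) _ _ (by simp)
    exact hcont hD
  refine limsup_le_of_le (by isBoundedDefault) ?_
  filter_upwards [self_mem_nhdsWithin, nhdsWithin_le_nhds hmem,
    nhdsWithin_le_nhds (closedBall_mem_nhds (0 : ℂ) hs)] with l hl0 hl hls
  have hl0 : l ≠ 0 := hl0
  have hn : 0 < ‖l‖ := norm_pos_iff.2 hl0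
  rw [ENNReal.div_le_iff_le_mul (by simp [hl0]) (by simp), ← ofReal_norm,
    ← ENNReal.ofReal_mul (by positivity), inv_mul_eq_div]
  refine (EReal.exp_monotone (greenFunction_le_of_discs hR hne hdisc hl0 hls hl)).trans_eq ?_
  rw [EReal.exp_coe, ← Real.log_div hn.ne' hs.ne', Real.exp_log (by positivity)]

end AzukawaDiscs

section GluedCompetitor

variable {E F : Type*} [NormedAddCommGroup E] [NormedAddCommGroup F] [InnerProductSpace ℂ F]

theorem ofReal_norm_div_le_sibonyMetric {D : Set F} {z : F} (hD : D ∈ 𝓝 z) {R : ℝ}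
    (hDR : ∀ w ∈ D, ‖w - z‖ < R) (X : F) : ENNReal.ofReal (‖X‖ / R) ≤ sibonyMetric D z X := by
  have hR : 0 < R := (norm_nonneg _).trans_lt (hDR z (mem_of_mem_nhds hD))
  have hv : IsSibonyCompetitor D z fun w => (R ^ 2)⁻¹ * ‖w - z‖ ^ 2 :=
    { nonneg := fun w _ => by positivity
      lt_one := fun w hw => by
        rw [inv_mul_lt_one₀ (by positivity)]
        exact pow_lt_pow_left₀ (hDR w hw) (norm_nonneg _) two_ne_zero
      map_base := by simp
      log_psh := isPSHOn_log_of_hasLogHarmonicSupportAt fun w _ => by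
        simpa only [Real.rpow_two] using (hasLogHarmonicSupportAt_norm_rpow (G := fun w => w - z)
          (Eventually.of_forall fun _ => by fun_prop) two_pos).const_mul (by positivity)
      smooth := contDiffAt_const.mul ((contDiffAt_id.sub contDiffAt_const).norm_sq ℂ) }
  refine hv.ofReal_le_sibonyMetric hD (Eventually.of_forall fun l => le_of_eq ?_)
  rw [add_sub_cancel_left, norm_smul]
  field_simp

theorem exists_rpow_eq_inv_two {τ : ℝ} (hτ : 0 < τ) (hτ2 : τ ≤ 2⁻¹) :
    ∃ ε : ℝ, 0 < ε ∧ ε ≤ 1 ∧ τ ^ ε = 2⁻¹ := by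
  have hlogτ : Real.log τ ≤ Real.log 2⁻¹ := Real.log_le_log hτ hτ2
  have hlog2 : Real.log 2⁻¹ < 0 := Real.log_neg (by norm_num) (by norm_num)
  exact ⟨Real.logb τ 2⁻¹, div_pos_of_neg_of_neg hlog2 (hlogτ.trans_lt hlog2),
    (div_le_one_of_neg (hlogτ.trans_lt hlog2)).2 hlogτ,
    Real.rpow_logb hτ (by linarith) (by norm_num)⟩

theorem norm_toLp_prod_le_add {G H : Type*} [SeminormedAddCommGroup G] [SeminormedAddCommGroup H]
    (x : G) (y : H) : ‖WithLp.toLp 2 (x, y)‖ ≤ ‖x‖ + ‖y‖ := by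
  refine le_of_sq_le_sq ?_ (by positivity)
  rw [WithLp.prod_norm_sq_eq_of_L2, WithLp.toLp_fst, WithLp.toLp_snd]
  nlinarith [mul_nonneg (norm_nonneg x) (norm_nonneg y)]

variable [NormedSpace ℂ E]

/-- The maximum of the norm of the map `(g, T / 2)` and of `2 * ‖T‖ ^ (1 + ε)`. Near a common
zero of `g` and `T` it equals the former. Where `T` is large compared with `g` it equals the
latter, and there its logarithm is plurisubharmonic even if `g` is not holomorphic. -/
def gluedNorm (g : E → ℂ) (T : E →L[ℂ] F) (ε : ℝ) (z : E) : ℝ :=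
  max ‖WithLp.toLp 2 (g z, (2⁻¹ : ℂ) • T z)‖ (2 * ‖T z‖ ^ (1 + ε))

variable {g : E → ℂ} {T : E →L[ℂ] F} {ε τ R : ℝ} {z q : E} {D : Set E}

theorem gluedNorm_nonneg : 0 ≤ gluedNorm g T ε z :=
  (norm_nonneg _).trans (le_max_left _ _)

theorem norm_le_gluedNorm : ‖g z‖ ≤ gluedNorm g T ε z :=
  (WithLp.norm_fst_le _ (WithLp.toLp 2 (g z, (2⁻¹ : ℂ) • T z))).trans (le_max_left _ _)

theorem eventually_gluedNorm_eq_norm (hε : 0 < ε) (hTq : T q = 0) :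
    gluedNorm g T ε =ᶠ[𝓝 q] fun z => ‖WithLp.toLp 2 (g z, (2⁻¹ : ℂ) • T z)‖ := by
  have hcont : ContinuousAt (fun z => ‖T z‖ ^ ε) q :=
    T.continuous.norm.continuousAt.rpow_const (Or.inr hε.le)
  have hsmall : ∀ᶠ z in 𝓝 q, ‖T z‖ ^ ε < 1 / 4 :=
    hcont.eventually_lt_const (by simp [hTq, hε.ne'])
  filter_upwards [hsmall] with z hz
  refine max_eq_left (le_trans ?_ (WithLp.norm_snd_le _ (WithLp.toLp 2 (g z, (2⁻¹ : ℂ) • T z))))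
  calc 2 * ‖T z‖ ^ (1 + ε) = 2 * (‖T z‖ * ‖T z‖ ^ ε) := by
        rw [Real.rpow_one_add' (norm_nonneg _) (by positivity)]
    _ ≤ ‖T z‖ / 2 := by nlinarith [norm_nonneg (T z)]
    _ = ‖(2⁻¹ : ℂ) • T z‖ := by rw [norm_smul, norm_inv, Complex.norm_two, inv_mul_eq_div]

theorem gluedNorm_eq_rpow (hτ : 0 < τ) (hε : 0 < ε) (hτε : τ ^ ε = 2⁻¹) (hg : ‖g z‖ ≤ τ / 2)
    (hz : τ ≤ ‖T z‖) : gluedNorm g T ε z = 2 * ‖T z‖ ^ (1 + ε) := by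
  refine max_eq_right ?_
  have hpow : 2⁻¹ ≤ ‖T z‖ ^ ε := hτε ▸ Real.rpow_le_rpow hτ.le hz hε.le
  calc ‖WithLp.toLp 2 (g z, (2⁻¹ : ℂ) • T z)‖ ≤ ‖g z‖ + ‖(2⁻¹ : ℂ) • T z‖ :=
        norm_toLp_prod_le_add _ _
    _ = ‖g z‖ + ‖T z‖ / 2 := by rw [norm_smul, norm_inv, Complex.norm_two, inv_mul_eq_div]
    _ ≤ 2 * (‖T z‖ * ‖T z‖ ^ ε) := by nlinarith [norm_nonneg (T z)]
    _ = 2 * ‖T z‖ ^ (1 + ε) := by rw [Real.rpow_one_add' (norm_nonneg _) (by positivity)]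

theorem gluedNorm_lt (hε : 0 < ε) (hε1 : ε ≤ 1) (hR : 1 ≤ R) (hTR : ‖T z‖ ≤ R)
    (hg : ‖g z‖ ≤ R) : gluedNorm g T ε z < 3 * R ^ 2 := by
  refine max_lt ((norm_toLp_prod_le_add _ _).trans_lt ?_) ?_
  · rw [norm_smul, norm_inv, Complex.norm_two]
    nlinarith
  · have hpow : ‖T z‖ ^ (1 + ε) ≤ R ^ 2 :=
      calc ‖T z‖ ^ (1 + ε) ≤ R ^ (1 + ε) := by gcongr
        _ ≤ R ^ (2 : ℝ) := Real.rpow_le_rpow_of_exponent_le hR (by linarith)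
        _ = R ^ 2 := Real.rpow_two R
    nlinarith

theorem contDiffAt_toLp_prod (hg : ContDiffAt ℂ 2 g z) :
    ContDiffAt ℂ 2 (fun w => WithLp.toLp 2 (g w, (2⁻¹ : ℂ) • T w)) z :=
  (WithLp.prodContinuousLinearEquiv 2 ℂ ℂ F).symm.contDiff.contDiffAt.comp z
    (hg.prodMk (T.contDiff.contDiffAt.const_smul _))

theorem hasLogHarmonicSupportAt_gluedNorm (hε : 0 < ε) (hτ : 0 < τ) (hτε : τ ^ ε = 2⁻¹)
    (hD : D ∈ 𝓝 z) (hg : ∀ w ∈ D, ‖g w‖ ≤ τ / 2)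
    (hz : ContDiffAt ℂ 2 g z ∨ ∀ᶠ w in 𝓝 z, w ∈ D → τ ≤ ‖T w‖) :
    HasLogHarmonicSupportAt (gluedNorm g T ε) z := by
  have hT : HasLogHarmonicSupportAt (fun w => 2 * ‖T w‖ ^ (1 + ε)) z :=
    (hasLogHarmonicSupportAt_norm_rpow (Eventually.of_forall fun _ => T.differentiableAt)
      (by positivity)).const_mul two_pos.le
  rcases hz with hz | hz
  · have hG : ∀ᶠ w in 𝓝 z, DifferentiableAt ℂ
        (fun w => WithLp.toLp 2 (g w, (2⁻¹ : ℂ) • T w)) w :=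
      ((contDiffAt_toLp_prod hz).eventually (by simp)).mono fun w hw =>
        hw.differentiableAt two_ne_zero
    simpa only [Real.rpow_one] using! (hasLogHarmonicSupportAt_norm_rpow hG one_pos).max hT
  · refine hT.congr ?_
    filter_upwards [hz, hD] with w hw hwD using gluedNorm_eq_rpow hτ hε hτε (hg w hwD) (hw hwD)

theorem isSibonyCompetitor_gluedNorm (hD : IsOpen D) (hε : 0 < ε) (hε1 : ε ≤ 1)
    (hτ : 0 < τ) (hτ2 : τ ≤ 2⁻¹) (hτε : τ ^ ε = 2⁻¹) (hR : 1 ≤ R) (hTR : ∀ w ∈ D, ‖T w‖ ≤ R)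
    (hg : ∀ w ∈ D, ‖g w‖ ≤ τ / 2) (hgq : g q = 0) (hTq : T q = 0)
    (hdiff : ContDiffAt ℂ 2 g q)
    (hglue : ∀ w ∈ D, ContDiffAt ℂ 2 g w ∨ ∀ᶠ y in 𝓝 w, y ∈ D → τ ≤ ‖T y‖) :
    IsSibonyCompetitor D q fun w => ((3 * R ^ 2)⁻¹ * gluedNorm g T ε w) ^ 2 where
  nonneg w _ := sq_nonneg _
  lt_one w hw := by
    rw [sq_lt_one_iff₀ (mul_nonneg (by positivity) gluedNorm_nonneg),
      inv_mul_lt_one₀ (by positivity)]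
    exact gluedNorm_lt hε hε1 hR (hTR w hw) ((hg w hw).trans (by linarith))
  map_base := by
    simp [(eventually_gluedNorm_eq_norm hε hTq).self_of_nhds, hgq, hTq]
  log_psh := isPSHOn_log_of_hasLogHarmonicSupportAt fun w hw =>
    ((hasLogHarmonicSupportAt_gluedNorm hε hτ hτε (hD.mem_nhds hw) hg (hglue w hw)).const_mul
      (by positivity)).sq (mul_nonneg (by positivity) gluedNorm_nonneg)
  smooth := by
    have hsq : ContDiffAt ℝ 2
        (fun w => ((3 * R ^ 2)⁻¹) ^ 2 * ‖WithLp.toLp 2 (g w, (2⁻¹ : ℂ) • T w)‖ ^ 2) q :=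
      contDiffAt_const.mul (((contDiffAt_toLp_prod hdiff).restrict_scalars ℝ).norm_sq ℂ)
    refine hsq.congr_of_eventuallyEq ?_
    filter_upwards [eventually_gluedNorm_eq_norm (g := g) hε hTq] with w hw
    rw [hw, mul_pow]

theorem ofReal_div_le_sibonyMetric_of_glue (hD : IsOpen D) (hq : q ∈ D) (hτ : 0 < τ)
    (hτ2 : τ ≤ 2⁻¹) (hR : 1 ≤ R) (hTR : ∀ w ∈ D, ‖T w‖ ≤ R) (hg : ∀ w ∈ D, ‖g w‖ ≤ τ / 2)
    (hgq : g q = 0) (hTq : T q = 0)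
    (hglue : ∀ w ∈ D, ContDiffAt ℂ 2 g w ∨ ∀ᶠ y in 𝓝 w, y ∈ D → τ ≤ ‖T y‖) {X : E} {k : ℝ}
    (hk0 : 0 ≤ k) (hk : ∀ᶠ l : ℂ in 𝓝[≠] 0, k * ‖l‖ ≤ ‖g (q + l • X)‖) :
    ENNReal.ofReal (k / (3 * R ^ 2)) ≤ sibonyMetric D q X := by
  obtain ⟨ε, hε, hε1, hτε⟩ := exists_rpow_eq_inv_two hτ hτ2
  have hdiff : ContDiffAt ℂ 2 g q := (hglue q hq).resolve_right fun h =>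
    (h.self_of_nhds hq).not_gt (by simpa [hTq] using hτ)
  have hv := isSibonyCompetitor_gluedNorm hD hε hε1 hτ hτ2 hτε hR hTR hg hgq hTq hdiff hglue
  refine hv.ofReal_le_sibonyMetric (hD.mem_nhds hq) (hk.mono fun l hl => ?_)
  rw [div_mul_eq_mul_div, div_eq_inv_mul]
  gcongr
  exact hl.trans norm_le_gluedNorm

end GluedCompetitor

section MoebiusCompetitor

/-- The Möbius transformation that sends `-1` to `0` and `2` to `∞`, replaced by `0` on the disc
of radius `r` around its pole. -/
def cutMoebius (r : ℝ) (x : ℂ) : ℂ :=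
  if ‖x - 2‖ ≤ r then 0 else (x + 1) / (x - 2)

variable {r : ℝ} {x : ℂ}

theorem cutMoebius_of_lt (hx : r < ‖x - 2‖) : cutMoebius r x = (x + 1) / (x - 2) :=
  if_neg hx.not_ge

theorem eventually_lt_norm_sub_two (hx : r < ‖x - 2‖) : ∀ᶠ y in 𝓝 x, r < ‖y - 2‖ :=
  continuousAt_const.eventually_lt (by fun_prop) hx

theorem norm_cutMoebius_le (hr : 0 < r) (hr1 : r ≤ 1) : ‖cutMoebius r x‖ ≤ 4 / r := by
  rcases le_or_gt ‖x - 2‖ r with hx | hx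
  · rw [cutMoebius, if_pos hx, norm_zero]
    positivity
  have hnum : ‖x + 1‖ ≤ ‖x - 2‖ + 3 :=
    calc ‖x + 1‖ = ‖(x - 2) + 3‖ := by ring_nf
      _ ≤ ‖x - 2‖ + 3 := by simpa using norm_add_le (x - 2) 3
  rw [cutMoebius_of_lt hx, norm_div, div_le_div_iff₀ (hr.trans hx) hr]
  nlinarith [norm_nonneg (x + 1)]

theorem contDiffAt_cutMoebius (hr : 0 ≤ r) (hx : r < ‖x - 2‖) {n : WithTop ℕ∞} :
    ContDiffAt ℂ n (cutMoebius r) x :=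
  ((contDiffAt_id.add contDiffAt_const).div (contDiffAt_id.sub contDiffAt_const)
    (norm_pos_iff.1 (hr.trans_lt hx))).congr_of_eventuallyEq
      ((eventually_lt_norm_sub_two hx).mono fun _ => cutMoebius_of_lt)

theorem eventually_norm_add_one_div_le_norm_cutMoebius (hr : 0 ≤ r) (hr3 : r < 3) :
    ∀ᶠ x in 𝓝 (-1), ‖x + 1‖ / 4 ≤ ‖cutMoebius r x‖ := by
  have hdist : ‖(-1 : ℂ) - 2‖ = 3 := by norm_num
  have hlt : ∀ᶠ x : ℂ in 𝓝 (-1), ‖x - 2‖ < 4 :=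
    ContinuousAt.eventually_lt (by fun_prop) continuousAt_const (by norm_num [hdist])
  filter_upwards [eventually_lt_norm_sub_two (hr3.trans_eq hdist.symm), hlt] with x hx hx4
  rw [cutMoebius_of_lt hx, norm_div]
  exact div_le_div_of_nonneg_left (norm_nonneg _) (hr.trans_lt hx) hx4.le

variable {E F : Type*} [NormedAddCommGroup E] [NormedSpace ℂ E] [NormedAddCommGroup F]
  [InnerProductSpace ℂ F]

theorem ofReal_le_sibonyMetric_of_gap {D : Set E} {q : E} {φ : E →L[ℂ] ℂ} {T : E →L[ℂ] F}
    {τ κ R : ℝ} (hD : IsOpen D) (hq : q ∈ D) (hφq : φ q = -1) (hTq : T q = 0) (hτ : 0 < τ)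
    (hτ2 : τ ≤ 2⁻¹) (hκ : 0 < κ) (hκ1 : κ ≤ 1) (hR : 1 ≤ R) (hTR : ∀ z ∈ D, ‖T z‖ ≤ R)
    (hgap : ∀ z ∈ D, ‖φ z - 2‖ < κ → τ ≤ ‖T z‖) (X : E) :
    ENNReal.ofReal (κ * τ / 64 * ‖φ X‖ / (3 * R ^ 2)) ≤ sibonyMetric D q X := by
  set A : ℝ := κ * τ / 16
  have hA : 0 < A := by positivity
  have hnorm (z : E) : ‖(A : ℂ) * cutMoebius (κ / 2) (φ z)‖ = A * ‖cutMoebius (κ / 2) (φ z)‖ := by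
    rw [norm_mul, Complex.norm_real, Real.norm_of_nonneg hA.le]
  refine ofReal_div_le_sibonyMetric_of_glue (g := fun z => A * cutMoebius (κ / 2) (φ z)) hD hq hτ
    hτ2 hR hTR (fun z _ => ?_) ?_ hTq (fun z _ => ?_) (by positivity) ?_
  · calc ‖(A : ℂ) * cutMoebius (κ / 2) (φ z)‖ ≤ A * (4 / (κ / 2)) := by
          rw [hnorm]
          gcongr
          exact norm_cutMoebius_le (by positivity) (by linarith)
      _ = τ / 2 := by simp only [A]; field_simp; norm_num
  · simp [hφq, cutMoebius]
  · rcases lt_or_ge (κ / 2) ‖φ z - 2‖ with hz | hz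
    · exact .inl <| contDiffAt_const.mul <|
        (contDiffAt_cutMoebius (by positivity) hz).comp z φ.contDiff.contDiffAt
    · have hnear : ∀ᶠ w in 𝓝 z, ‖φ w - 2‖ < κ :=
        ContinuousAt.eventually_lt (by fun_prop) continuousAt_const (by linarith)
      exact .inr (hnear.mono fun w hw hwD => hgap w hwD hw)
  · have hline : Tendsto (fun l : ℂ => φ (q + l • X)) (𝓝[≠] 0) (𝓝 (-1)) :=
      (Continuous.tendsto' (by fun_prop) _ _ (by simp [hφq])).mono_left nhdsWithin_le_nhds
    filter_upwards [hline.eventually (eventually_norm_add_one_div_le_norm_cutMoebius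
      (r := κ / 2) (by positivity) (by linarith))] with l hl
    have hφl : φ (q + l • X) + 1 = l * φ X := by simp [hφq]
    rw [hφl, norm_mul] at hl
    rw [hnorm]
    calc κ * τ / 64 * ‖φ X‖ * ‖l‖ = A * (‖l‖ * ‖φ X‖ / 4) := by simp only [A]; ring
      _ ≤ A * ‖cutMoebius (κ / 2) (φ (q + l • X))‖ := by gcongr

end MoebiusCompetitor

section Profile

variable {f : ℝ≥0 → ℝ≥0} {t x : ℝ≥0}

theorem pos_of_apply_pos (hf0 : f 0 = 0) (ht : 0 < f t) : 0 < t :=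
  pos_iff_ne_zero.2 fun h => by simp [h, hf0] at ht

theorem div_mul_le_of_monotoneOn_div (hmono : MonotoneOn (fun t => f t / t) (Set.Ioi 0))
    (ht : 0 < t) (hx : t ≤ x) : f t / t * x ≤ f x :=
  (le_div_iff₀ (ht.trans_le hx)).1 (hmono ht (ht.trans_le hx) hx)

theorem le_of_apply_lt_apply (hf0 : f 0 = 0)
    (hmono : MonotoneOn (fun t => f t / t) (Set.Ioi 0)) (h : f t < f x) : t ≤ x := by
  by_contra! hxt
  have hx : 0 < x := pos_of_apply_pos hf0 (zero_le.trans_lt h)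
  have hle : f x ≤ f t := by
    calc f x = f x / x * x := (div_mul_cancel₀ _ hx.ne').symm
      _ ≤ f x / x * t := by gcongr
      _ ≤ f t := div_mul_le_of_monotoneOn_div hmono hx hxt.le
  exact hle.not_gt h

theorem div_mul_lt_add_of_monotoneOn_div (hmono : MonotoneOn (fun t => f t / t) (Set.Ioi 0))
    (ht : 0 < t) (hft : 0 < f t) (x : ℝ≥0) : f t / t * x < f t + f x := by
  rcases lt_or_ge x t with hx | hx
  · calc f t / t * x < f t / t * t := by gcongr
      _ = f t := div_mul_cancel₀ _ ht.ne'
      _ ≤ f t + f x := le_self_add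
  · exact (div_mul_le_of_monotoneOn_div hmono ht hx).trans_lt (lt_add_of_pos_left _ hft)

end Profile

section TangentialPart

variable {E : Type*} [NormedAddCommGroup E] [InnerProductSpace ℂ E] {ν : E}

/-- The orthogonal projection onto the complex tangent space, the orthogonal complement of the
complex line spanned by the normal vector `ν`. It plays the role of `z ↦ z'`. -/
def tangentialPart (ν : E) : E →L[ℂ] E :=
  (ℂ ∙ ν)ᗮ.starProjection

theorem norm_tangentialPart_le (ν z : E) : ‖tangentialPart ν z‖ ≤ ‖z‖ :=
  Submodule.norm_starProjection_apply_le _ _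

theorem tangentialPart_self (ν : E) : tangentialPart ν ν = 0 :=
  Submodule.starProjection_orthogonalComplement_singleton_eq_zero ν

theorem tangentialPart_add_smul {e : E} (hνe : inner ℂ ν e = 0) (X : E) (ζ : ℂ) :
    tangentialPart ν (X + ζ • e) = tangentialPart ν X + ζ • e := by
  have he : tangentialPart ν e = e := Submodule.starProjection_eq_self_iff.2
    (Submodule.mem_orthogonal_singleton_iff_inner_right.2 hνe)
  rw [map_add, map_smul, he]

theorem norm_tangentialPart_add_smul_le {e : E} (he : ‖e‖ = 1) (hνe : inner ℂ ν e = 0) (X : E)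
    (ζ : ℂ) : ‖tangentialPart ν (X + ζ • e)‖ ≤ ‖tangentialPart ν X‖ + ‖ζ‖ := by
  simpa [tangentialPart_add_smul hνe, norm_smul, he] using
    norm_add_le (tangentialPart ν X) (ζ • e)

theorem norm_sub_le_norm_tangentialPart_add_smul {e : E} (he : ‖e‖ = 1)
    (hνe : inner ℂ ν e = 0) (X : E) (ζ : ℂ) :
    ‖ζ‖ - ‖tangentialPart ν X‖ ≤ ‖tangentialPart ν (X + ζ • e)‖ := by
  simpa [tangentialPart_add_smul hνe, norm_smul, he, add_comm] using
    norm_sub_le_norm_add (ζ • e) (tangentialPart ν X)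

theorem tangentialPart_eq_sub (hν : ‖ν‖ = 1) (z : E) :
    tangentialPart ν z = z - inner ℂ ν z • ν := by
  rw [tangentialPart, Submodule.starProjection_orthogonal_val,
    Submodule.starProjection_unit_singleton ℂ hν]

theorem norm_le_norm_inner_add_norm_tangentialPart (hν : ‖ν‖ = 1) (z : E) :
    ‖z‖ ≤ ‖inner ℂ ν z‖ + ‖tangentialPart ν z‖ :=
  calc ‖z‖ = ‖inner ℂ ν z • ν + tangentialPart ν z‖ := by
        rw [tangentialPart_eq_sub hν, add_sub_cancel]
    _ ≤ ‖inner ℂ ν z • ν‖ + ‖tangentialPart ν z‖ := norm_add_le _ _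
    _ = _ := by rw [norm_smul, hν, mul_one]

theorem inner_normal_smul (hν : ‖ν‖ = 1) (c : ℂ) : inner ℂ ν (c • ν) = c := by
  rw [inner_smul_right, inner_self_eq_one_of_norm_eq_one hν, mul_one]

/-- The part in the ball of radius `r` of the model domain `Re z₁ + C |Im z₁| < f ‖z'‖`, where
`z₁` is the coordinate in the direction of `ν` and `z'` the tangential part. With `C` and `-C` it
bounds a domain `Re z₁ + O(|Im z₁|) < f ‖z'‖` from inside and from outside. -/
def profileRegion (f : ℝ≥0 → ℝ≥0) (ν : E) (C r : ℝ) : Set E :=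
  {z | ‖z‖ < r ∧ (inner ℂ ν z).re + C * |(inner ℂ ν z).im| < f ‖tangentialPart ν z‖₊}

end TangentialPart

section UpperBound

open Metric Set

variable {E : Type*} [NormedAddCommGroup E] [InnerProductSpace ℂ E] {ν e X Y : E} {D : Set E}
  {f : ℝ≥0 → ℝ≥0} {t a : ℝ≥0} {C r₀ s R : ℝ}

theorem neg_smul_add_mem (hν : ‖ν‖ = 1) (hmono : MonotoneOn (fun t => f t / t) (Ioi 0))
    (hC : 0 ≤ C) (hin : profileRegion f ν C r₀ ⊆ D)
    (ht : 0 < t) (hft : 0 < f t)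
    (hY : (1 + C) * ‖inner ℂ ν Y‖ ≤ f t / t * ‖tangentialPart ν Y‖)
    (hYr : f t + (f t / t + 1) * ‖tangentialPart ν Y‖ < r₀) : -(f t : ℂ) • ν + Y ∈ D := by
  have hinner : inner ℂ ν (-(f t : ℂ) • ν + Y) = -(f t : ℂ) + inner ℂ ν Y := by
    rw [inner_add_right, inner_normal_smul hν]
  have htang : tangentialPart ν (-(f t : ℂ) • ν + Y) = tangentialPart ν Y := by
    rw [map_add, map_smul, tangentialPart_self, smul_zero, zero_add]
  refine hin ⟨?_, ?_⟩
  · calc ‖-(f t : ℂ) • ν + Y‖ ≤ f t + ‖Y‖ := by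
          refine (norm_add_le _ _).trans_eq ?_
          simp [norm_smul, hν]
      _ ≤ f t + (f t / t * ‖tangentialPart ν Y‖ + ‖tangentialPart ν Y‖) := by
        have := norm_le_norm_inner_add_norm_tangentialPart hν Y
        have := mul_nonneg hC (norm_nonneg (inner ℂ ν Y))
        linarith
      _ < r₀ := by linarith
  · have hprofile : (f t / t * ‖tangentialPart ν Y‖ : ℝ) < f t + f ‖tangentialPart ν Y‖₊ := by
      exact_mod_cast div_mul_lt_add_of_monotoneOn_div hmono ht hft ‖tangentialPart ν Y‖₊
    have hre := (inner ℂ ν Y).re_le_norm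
    have him := mul_le_mul_of_nonneg_left (inner ℂ ν Y).abs_im_le_norm hC
    rw [hinner, htang]
    simp only [Complex.add_re, Complex.add_im, Complex.neg_re, Complex.neg_im,
      Complex.ofReal_re, Complex.ofReal_im, neg_zero, zero_add]
    linarith

theorem neg_smul_mem (hν : ‖ν‖ = 1) (hf0 : f 0 = 0) (hin : profileRegion f ν C r₀ ⊆ D)
    {δ : ℝ} (hδ : 0 < δ) (hδr : δ < r₀) : -(δ : ℂ) • ν ∈ D := by
  refine hin ⟨?_, ?_⟩
  · simpa [norm_smul, hν, abs_of_pos hδ] using hδr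
  · rw [inner_normal_smul hν, map_smul, tangentialPart_self, smul_zero, nnnorm_zero, hf0]
    simpa using hδ

theorem azukawaMetric_le_of_lt (hν : ‖ν‖ = 1) (he : ‖e‖ = 1) (hνe : inner ℂ ν e = 0)
    (hmono : MonotoneOn (fun t => f t / t) (Ioi 0)) (hC : 0 ≤ C)
    (hin : profileRegion f ν C r₀ ⊆ D)
    (ht : 0 < t) (hft : 0 < f t) (hD : D ∈ 𝓝 (-(f t : ℂ) • ν)) (hs : 0 < s)
    (hsr : f t + (f t / t + 1) * s < r₀)
    (hR : ‖tangentialPart ν X‖ + (1 + C) * (t / f t * ‖inner ℂ ν X‖) < R) :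
    azukawaMetric D (-(f t : ℂ) • ν) X ≤ ENNReal.ofReal (2 * R / s) := by
  have hslope : 0 ≤ (1 + C) * (t / f t * ‖inner ℂ ν X‖) := by positivity
  have hR0 : 0 < R := by linarith [norm_nonneg (tangentialPart ν X)]
  have hlower {ζ : ℂ} (hζ : ζ ∈ sphere (0 : ℂ) R) :
      (1 + C) * (t / f t * ‖inner ℂ ν X‖) < ‖tangentialPart ν (X + ζ • e)‖ := by
    have := norm_sub_le_norm_tangentialPart_add_smul he hνe X ζ
    rw [mem_sphere_zero_iff_norm.1 hζ] at this
    linarith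
  have hupper {ζ : ℂ} (hζ : ζ ∈ sphere (0 : ℂ) R) : ‖tangentialPart ν (X + ζ • e)‖ ≤ 2 * R := by
    have := norm_tangentialPart_add_smul_le he hνe X ζ
    rw [mem_sphere_zero_iff_norm.1 hζ] at this
    linarith
  rw [← inv_div]
  refine azukawaMetric_le_of_discs (e := e) hD hR0.le (by positivity)
    (fun ζ hζ h0 => ?_) fun ζ hζ l hl => neg_smul_add_mem hν hmono hC hin ht hft ?_ ?_
  · simpa [h0] using hslope.trans_lt (hlower hζ)
  · rw [inner_smul_right, inner_add_right, inner_smul_right, hνe, mul_zero, add_zero, map_smul,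
      norm_mul, norm_smul, mul_left_comm, mul_left_comm _ ‖l‖]
    refine mul_le_mul_of_nonneg_left ?_ (norm_nonneg l)
    calc (1 + C) * ‖inner ℂ ν X‖ = f t / t * ((1 + C) * (t / f t * ‖inner ℂ ν X‖)) := by
          field_simp
      _ ≤ f t / t * ‖tangentialPart ν (X + ζ • e)‖ := by gcongr; exact (hlower hζ).le
  · refine lt_of_le_of_lt ?_ hsr
    gcongr
    calc ‖tangentialPart ν (l • (X + ζ • e))‖ = ‖l‖ * ‖tangentialPart ν (X + ζ • e)‖ := by
          rw [map_smul, norm_smul]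
      _ ≤ s / (2 * R) * (2 * R) := by
        gcongr
        exacts [mem_closedBall_zero_iff.1 hl, hupper hζ]
      _ = s := div_mul_cancel₀ _ (by positivity)

theorem azukawaMetric_le_of_profile (hν : ‖ν‖ = 1) (he : ‖e‖ = 1) (hνe : inner ℂ ν e = 0)
    (hmono : MonotoneOn (fun t => f t / t) (Ioi 0)) (hC : 0 ≤ C)
    (hin : profileRegion f ν C r₀ ⊆ D)
    (ht : 0 < t) (hft : 0 < f t) (hD : D ∈ 𝓝 (-(f t : ℂ) • ν)) (hs : 0 < s)
    (hsr : f t + (f t / t + 1) * s < r₀) (X : E) :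
    azukawaMetric D (-(f t : ℂ) • ν) X ≤
      ENNReal.ofReal (2 * (1 + C) / s * (t / f t * ‖inner ℂ ν X‖ + ‖X‖)) := by
  set N := ‖tangentialPart ν X‖ + (1 + C) * (t / f t * ‖inner ℂ ν X‖)
  have hlim : Tendsto (fun R : ℝ => ENNReal.ofReal (2 * R / s)) (𝓝[>] N)
      (𝓝 (ENNReal.ofReal (2 * N / s))) :=
    ((ENNReal.continuous_ofReal.comp (by fun_prop)).tendsto N).mono_left nhdsWithin_le_nhds
  have hN : N ≤ (1 + C) * (t / f t * ‖inner ℂ ν X‖ + ‖X‖) := by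
    have := norm_tangentialPart_le ν X
    have := mul_nonneg hC (norm_nonneg X)
    linarith
  refine (ge_of_tendsto hlim (eventually_mem_nhdsWithin.mono fun R hR =>
    azukawaMetric_le_of_lt hν he hνe hmono hC hin ht hft hD hs hsr hR)).trans
    (ENNReal.ofReal_le_ofReal ?_)
  calc 2 * N / s ≤ 2 * ((1 + C) * (t / f t * ‖inner ℂ ν X‖ + ‖X‖)) / s := by gcongr
    _ = _ := by ring

theorem exists_azukawaMetric_le (hν : ‖ν‖ = 1) (he : ‖e‖ = 1) (hνe : inner ℂ ν e = 0)
    (hf0 : f 0 = 0) (hmono : MonotoneOn (fun t => f t / t) (Ioi 0)) (hDopen : IsOpen D)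
    (hC : 0 ≤ C) (hr₀ : 0 < r₀) (hin : profileRegion f ν C r₀ ⊆ D) (a : ℝ≥0) :
    ∃ c : ℝ, ∀ t ≤ a, 0 < f t → f t < r₀ / 6 → ∀ X : E,
      azukawaMetric D (-(f t : ℂ) • ν) X ≤
        ENNReal.ofReal (c * (t / f t * ‖inner ℂ ν X‖ + ‖X‖)) := by
  set K : ℝ := f a / a
  have hK : 0 ≤ K := by positivity
  refine ⟨2 * (1 + C) / (r₀ / (2 * (K + 1))), fun t hta hft hftr X => ?_⟩
  have ht : 0 < t := pos_of_apply_pos hf0 hft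
  have hslope : (f t / t : ℝ) ≤ K := by exact_mod_cast hmono ht (ht.trans_le hta) hta
  have hq : -(f t : ℂ) • ν ∈ D := by
    exact_mod_cast neg_smul_mem hν hf0 hin (NNReal.coe_pos.2 hft) (by linarith)
  refine azukawaMetric_le_of_profile hν he hνe hmono hC hin ht hft (hDopen.mem_nhds hq)
    (by positivity) ?_ X
  calc f t + (f t / t + 1) * (r₀ / (2 * (K + 1)))
      ≤ f t + (K + 1) * (r₀ / (2 * (K + 1))) := by gcongr
    _ = f t + r₀ / 2 := by field_simp
    _ < r₀ := by linarith

end UpperBound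

section LowerBound

open Metric Set

variable {E : Type*} [NormedAddCommGroup E] [InnerProductSpace ℂ E] {ν : E} {D : Set E}
  {f : ℝ≥0 → ℝ≥0} {C r₀ : ℝ}

theorem min_le_norm_tangentialPart {t : ℝ≥0} (hν : ‖ν‖ = 1) (hf0 : f 0 = 0)
    (hmono : MonotoneOn (fun t => f t / t) (Ioi 0)) (hC : 0 ≤ C)
    (hout : D ∩ ball 0 r₀ ⊆ profileRegion f ν (-C) r₀) (hftr : f t < r₀ / 6) {z : E}
    (hz : z ∈ D) (hgap : (1 + C) * ‖inner ℂ ν z - 2 * (f t : ℂ)‖ < f t) :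
    min (t : ℝ) (r₀ / 2) ≤ ‖tangentialPart ν z‖ := by
  set x : ℂ := inner ℂ ν z - 2 * (f t : ℂ)
  have hinner : inner ℂ ν z = x + ((2 * f t : ℝ) : ℂ) := by simp [x]
  have hCx := mul_nonneg hC (norm_nonneg x)
  rcases lt_or_ge ‖z‖ r₀ with hzr | hzr
  · have hprofile := (hout ⟨hz, mem_ball_zero_iff.2 hzr⟩).2
    rw [hinner] at hprofile
    simp only [Complex.add_re, Complex.add_im, Complex.ofReal_re, Complex.ofReal_im,
      add_zero] at hprofile
    have hre := (abs_le.1 x.abs_re_le_norm).1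
    have him := mul_le_mul_of_nonneg_left x.abs_im_le_norm hC
    have hlt : (f t : ℝ) < f ‖tangentialPart ν z‖₊ := by linarith
    exact (min_le_left _ _).trans
      (NNReal.coe_le_coe.2 (le_of_apply_lt_apply hf0 hmono (NNReal.coe_lt_coe.1 hlt)))
  · have hnorm : ‖inner ℂ ν z‖ ≤ ‖x‖ + 2 * f t := by
      rw [hinner]
      exact (norm_add_le _ _).trans_eq (by simp)
    have := norm_le_norm_inner_add_norm_tangentialPart hν z
    exact (min_le_right _ _).trans (by linarith)

theorem exists_ofReal_inner_le_sibonyMetric (hν : ‖ν‖ = 1) (hf0 : f 0 = 0)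
    (hmono : MonotoneOn (fun t => f t / t) (Ioi 0)) (hDopen : IsOpen D)
    (hDbdd : Bornology.IsBounded D) (hC : 0 ≤ C) (hr₀ : 0 < r₀)
    (hout : D ∩ ball 0 r₀ ⊆ profileRegion f ν (-C) r₀) (a : ℝ≥0) :
    ∃ k : ℝ, 0 < k ∧ ∀ t ≤ a, 0 < f t → f t < r₀ / 6 → -(f t : ℂ) • ν ∈ D → ∀ X : E,
      ENNReal.ofReal (k * (t / f t * ‖inner ℂ ν X‖)) ≤
        sibonyMetric D (-(f t : ℂ) • ν) X := by
  obtain ⟨R, hR, hDR⟩ := hDbdd.exists_pos_norm_le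
  set M := max R 1
  set τ₀ := min (r₀ / 2) 2⁻¹
  have hM : 1 ≤ M := le_max_right _ _
  have hτ₀ : 0 < τ₀ := by positivity
  refine ⟨(1 + C)⁻¹ / (1 + a / τ₀) / 64 / (3 * M ^ 2), by positivity,
    fun t hta hft hftr hq X => ?_⟩
  have ht : (0 : ℝ) < t := pos_of_apply_pos hf0 hft
  have hft' : (0 : ℝ) < f t := hft
  have hτ : t / (1 + a / τ₀) ≤ min (t : ℝ) τ₀ := by
    rw [div_le_iff₀ (by positivity)]
    rcases min_choice (t : ℝ) τ₀ with h | h <;> rw [h, mul_add, mul_one]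
    · exact le_add_of_nonneg_right (by positivity)
    · rw [mul_div_cancel₀ _ hτ₀.ne']
      exact le_add_of_nonneg_of_le hτ₀.le hta
  have hφ (z : E) : ((f t : ℂ)⁻¹ • innerSL ℂ ν) z = (f t : ℂ)⁻¹ * inner ℂ ν z := rfl
  refine le_trans (ENNReal.ofReal_le_ofReal ?_) (ofReal_le_sibonyMetric_of_gap
    (φ := (f t : ℂ)⁻¹ • innerSL ℂ ν) (T := tangentialPart ν) (τ := min (t : ℝ) τ₀)
    (κ := (1 + C)⁻¹) (R := M) hDopen hq ?_ ?_ (by positivity)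
    ((min_le_right _ _).trans (min_le_right _ _)) (by positivity)
    (inv_le_one_of_one_le₀ (by linarith)) hM
    (fun z hz => (norm_tangentialPart_le ν z).trans ((hDR z hz).trans (le_max_left _ _)))
    (fun z hz hgap => ?_) X)
  · rw [hφ, norm_mul, norm_inv, Complex.norm_real, Real.norm_of_nonneg hft'.le]
    calc _ = (1 + C)⁻¹ * (t / (1 + a / τ₀)) / 64 * ((f t : ℝ)⁻¹ * ‖inner ℂ ν X‖) /
          (3 * M ^ 2) := by ring
      _ ≤ _ := by gcongr
  · rw [hφ, inner_normal_smul hν, mul_neg, inv_mul_cancel₀ (by exact_mod_cast hft.ne')]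
  · rw [map_smul, tangentialPart_self, smul_zero]
  · have hscale : inner ℂ ν z - 2 * (f t : ℂ) = f t * ((f t : ℂ)⁻¹ * inner ℂ ν z - 2) := by
      have : (f t : ℂ) ≠ 0 := by exact_mod_cast hft.ne'
      field_simp
    refine (min_le_min_left _ (min_le_left _ _)).trans
      (min_le_norm_tangentialPart hν hf0 hmono hC hout hftr hz ?_)
    rw [hscale, ← hφ, norm_mul, Complex.norm_real, Real.norm_of_nonneg hft'.le]
    calc _ < (1 + C) * (f t * (1 + C)⁻¹) := by gcongr
      _ = f t := by field_simp

theorem exists_ofReal_le_sibonyMetric (hν : ‖ν‖ = 1) (hf0 : f 0 = 0)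
    (hmono : MonotoneOn (fun t => f t / t) (Ioi 0)) (hDopen : IsOpen D)
    (hDbdd : Bornology.IsBounded D) (hC : 0 ≤ C) (hr₀ : 0 < r₀)
    (hout : D ∩ ball 0 r₀ ⊆ profileRegion f ν (-C) r₀) (a : ℝ≥0) :
    ∃ k : ℝ, 0 < k ∧ ∀ t ≤ a, 0 < f t → f t < r₀ / 6 → -(f t : ℂ) • ν ∈ D → ∀ X : E,
      ENNReal.ofReal (k * (t / f t * ‖inner ℂ ν X‖ + ‖X‖)) ≤
        sibonyMetric D (-(f t : ℂ) • ν) X := by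
  obtain ⟨k, hk, hnormal⟩ :=
    exists_ofReal_inner_le_sibonyMetric hν hf0 hmono hDopen hDbdd hC hr₀ hout a
  obtain ⟨R, hR, hDR⟩ := hDbdd.exists_pos_norm_le
  refine ⟨min k (2 * R + 1)⁻¹ / 2, by positivity, fun t hta hft hftr hq X => ?_⟩
  have hball : ∀ w ∈ D, ‖w - -(f t : ℂ) • ν‖ < 2 * R + 1 := fun w hw => by
    linarith [norm_sub_le w (-(f t : ℂ) • ν), hDR w hw, hDR _ hq]
  refine le_trans ?_ (max_le (hnormal t hta hft hftr hq X)
    (ofReal_norm_div_le_sibonyMetric (hDopen.mem_nhds hq) hball X))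
  rw [← ENNReal.ofReal_max]
  refine ENNReal.ofReal_le_ofReal ?_
  have hnormalTerm : min k (2 * R + 1)⁻¹ * (t / f t * ‖inner ℂ ν X‖) ≤
      k * (t / f t * ‖inner ℂ ν X‖) := by
    gcongr
    exact min_le_left _ _
  have hnormTerm : min k (2 * R + 1)⁻¹ * ‖X‖ ≤ ‖X‖ / (2 * R + 1) := by
    rw [div_eq_inv_mul]
    gcongr
    exact min_le_right _ _
  linarith [le_max_left (k * (t / f t * ‖inner ℂ ν X‖)) (‖X‖ / (2 * R + 1)),
    le_max_right (k * (t / f t * ‖inner ℂ ν X‖)) (‖X‖ / (2 * R + 1))]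

end LowerBound

section LocalModel

open Metric

variable {E : Type*} [NormedAddCommGroup E] [InnerProductSpace ℂ E] {ν : E} {D : Set E}
  {f : ℝ≥0 → ℝ≥0}

theorem exists_profileRegion_subset {h : E → ℝ} (hO : h =O[𝓝 0] fun z => (inner ℂ ν z).im)
    (hD : ∀ᶠ z in 𝓝 (0 : E),
      z ∈ D ↔ (inner ℂ ν z).re + h z < (f ‖tangentialPart ν z‖₊ : ℝ)) :
    ∃ C r : ℝ, 0 ≤ C ∧ 0 < r ∧ profileRegion f ν C r ⊆ D ∧
      D ∩ ball 0 r ⊆ profileRegion f ν (-C) r := by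
  obtain ⟨C, hC, hbound⟩ := hO.exists_nonneg
  obtain ⟨r, hr, hball⟩ := nhds_basis_ball.eventually_iff.1 (hD.and hbound.bound)
  refine ⟨C, r, hC, hr, fun z ⟨hz, hlt⟩ => ?_, fun z ⟨hzD, hz⟩ => ⟨by simpa using hz, ?_⟩⟩
  · obtain ⟨hiff, hh⟩ := hball (mem_ball_zero_iff.2 hz)
    rw [Real.norm_eq_abs, Real.norm_eq_abs] at hh
    exact hiff.2 (by linarith [le_abs_self (h z)])
  · obtain ⟨hiff, hh⟩ := hball hz
    rw [Real.norm_eq_abs, Real.norm_eq_abs] at hh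
    linarith [hiff.1 hzD, neg_abs_le (h z)]

end LocalModel

theorem exists_metric_bounds {E : Type*} [NormedAddCommGroup E] [InnerProductSpace ℂ E]
    {ν e : E} (hν : ‖ν‖ = 1) (he : ‖e‖ = 1) (hνe : inner ℂ ν e = 0)
    {f : ℝ≥0 → ℝ≥0} (hf0 : f 0 = 0) (hmono : MonotoneOn (fun t => f t / t) (Set.Ioi 0))
    {D : Set E} (hDopen : IsOpen D) (hDbdd : Bornology.IsBounded D) {C r₀ : ℝ} (hC : 0 ≤ C)
    (hr₀ : 0 < r₀) (hin : profileRegion f ν C r₀ ⊆ D)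
    (hout : D ∩ Metric.ball 0 r₀ ⊆ profileRegion f ν (-C) r₀) (a : ℝ≥0) :
    ∃ c : ℝ, 1 < c ∧ ∀ t ≤ a, 0 < f t → f t < r₀ / 6 → -(f t : ℂ) • ν ∈ D ∧ ∀ X : E,
      ENNReal.ofReal (c⁻¹ * (t / f t * ‖inner ℂ ν X‖ + ‖X‖)) ≤
          sibonyMetric D (-(f t : ℂ) • ν) X ∧
      sibonyMetric D (-(f t : ℂ) • ν) X ≤ azukawaMetric D (-(f t : ℂ) • ν) X ∧
      azukawaMetric D (-(f t : ℂ) • ν) X ≤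
          ENNReal.ofReal (c * (t / f t * ‖inner ℂ ν X‖ + ‖X‖)) := by
  obtain ⟨c₁, hupper⟩ := exists_azukawaMetric_le hν he hνe hf0 hmono hDopen hC hr₀ hin a
  obtain ⟨k, hk, hlower⟩ :=
    exists_ofReal_le_sibonyMetric hν hf0 hmono hDopen hDbdd hC hr₀ hout a
  set c := max 2 (max c₁ k⁻¹)
  have hc₁ : c₁ ≤ c := (le_max_left _ _).trans (le_max_right _ _)
  have hck : c⁻¹ ≤ k := inv_le_of_inv_le₀ hk ((le_max_right _ _).trans (le_max_right _ _))
  refine ⟨c, one_lt_two.trans_le (le_max_left _ _), fun t hta hft hftr => ?_⟩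
  have hq : -(f t : ℂ) • ν ∈ D :=
    neg_smul_mem hν hf0 hin (NNReal.coe_pos.2 hft) (by linarith)
  refine ⟨hq, fun X => ⟨(ENNReal.ofReal_le_ofReal ?_).trans (hlower t hta hft hftr hq X),
    sibonyMetric_le_azukawaMetric (hDopen.mem_nhds hq) X,
    (hupper t hta hft hftr X).trans (ENNReal.ofReal_le_ofReal ?_)⟩⟩ <;> gcongr

theorem inner_single_zero_one {m : ℕ} (z : EuclideanSpace ℂ (Fin (m + 1))) :
    inner ℂ (EuclideanSpace.single 0 1) z = z 0 := by
  rw [EuclideanSpace.inner_single_left, map_one, one_mul]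

theorem nnnorm_tangentialPart_single {m : ℕ} (z : EuclideanSpace ℂ (Fin (m + 1))) :
    ‖tangentialPart (EuclideanSpace.single 0 1) z‖₊ = ‖tail z‖₊ := by
  rw [tangentialPart_eq_sub (by simp), inner_single_zero_one, EuclideanSpace.nnnorm_eq,
    EuclideanSpace.nnnorm_eq, Fin.sum_univ_succ]
  simp [tail]

theorem neg_smul_single_eq_basePoint (m : ℕ) (δ : ℝ) :
    -(δ : ℂ) • EuclideanSpace.single 0 1 = basePoint m δ := by
  ext i
  by_cases hi : i = 0 <;> simp [basePoint, hi]

end InvariantMetrics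

end

open InvariantMetrics in
theorem proposition6_general {E : Type*} [NormedAddCommGroup E] [InnerProductSpace ℂ E]
    {ν e : E} (hν : ‖ν‖ = 1) (he : ‖e‖ = 1) (hνe : inner ℂ ν e = 0)
    {f : ℝ≥0 → ℝ≥0} (hf : Continuous f) (hf0 : f 0 = 0) (hfne : f ≠ 0)
    (hmono : MonotoneOn (fun t => f t / t) (Set.Ioi 0))
    {D : Set E} (hDopen : IsOpen D) (hDbdd : Bornology.IsBounded D)
    {h : E → ℝ} (hO : h =O[𝓝 0] fun z => (inner ℂ ν z).im)
    (hD : ∀ᶠ z in 𝓝 (0 : E),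
      z ∈ D ↔ (inner ℂ ν z).re + h z < (f ‖tangentialPart ν z‖₊ : ℝ)) :
    ∃ c : ℝ, 1 < c ∧ ∃ δ₀ : ℝ, 0 < δ₀ ∧ ∀ δ : ℝ, 0 < δ → δ < δ₀ →
      -(δ : ℂ) • ν ∈ D ∧ ∀ X : E,
        ENNReal.ofReal (c⁻¹ * ((Function.invFun f δ.toNNReal : ℝ≥0) / δ * ‖inner ℂ ν X‖ + ‖X‖)) ≤
          sibonyMetric D (-(δ : ℂ) • ν) X ∧
        sibonyMetric D (-(δ : ℂ) • ν) X ≤ azukawaMetric D (-(δ : ℂ) • ν) X ∧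
        azukawaMetric D (-(δ : ℂ) • ν) X ≤
        ENNReal.ofReal (c * ((Function.invFun f δ.toNNReal : ℝ≥0) / δ * ‖inner ℂ ν X‖ + ‖X‖)) := by
  obtain ⟨C, r₀, hC, hr₀, hin, hout⟩ := exists_profileRegion_subset hO hD
  obtain ⟨a, ha⟩ := Function.ne_iff.1 hfne
  have hfa : (0 : ℝ) < f a := NNReal.coe_pos.2 (pos_iff_ne_zero.2 ha)
  obtain ⟨c, hc, hbounds⟩ :=
    exists_metric_bounds hν he hνe hf0 hmono hDopen hDbdd hC hr₀ hin hout a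
  refine ⟨c, hc, min (f a) (r₀ / 6), by positivity, fun δ hδ hδ₀ => ?_⟩
  lift δ to ℝ≥0 using hδ.le
  obtain ⟨hδa, hδr⟩ := lt_min_iff.1 hδ₀
  have hft : f (Function.invFun f δ) = δ :=
    Function.invFun_eq (existsUnique_preimage hf hf0 hfne hmono hδ).exists
  have hta : Function.invFun f δ ≤ a :=
    le_of_apply_lt_apply hf0 hmono (hft.trans_lt (NNReal.coe_lt_coe.1 hδa))
  simpa only [hft, Real.toNNReal_coe] using
    hbounds _ hta (hft.symm ▸ hδ) (hft.symm ▸ hδr)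

theorem proposition6 (m : ℕ) (hm : 1 ≤ m)
    (f : ℝ≥0 → ℝ≥0) (hf : Continuous f) (hf0 : f 0 = 0) (hfne : f ≠ 0)
    (hmono : MonotoneOn (fun t => f t / t) (Set.Ioi 0))
    (D : Set (EuclideanSpace ℂ (Fin (m + 1))))
    (hDopen : IsOpen D) (hDconn : IsConnected D) (hDbdd : Bornology.IsBounded D)
    (h0 : (0 : EuclideanSpace ℂ (Fin (m + 1))) ∈ frontier D)
    (h : EuclideanSpace ℂ (Fin (m + 1)) → ℝ)
    (hO : h =O[𝓝 0] fun z => (z 0).im)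
    (hD : ∀ᶠ z in 𝓝 (0 : EuclideanSpace ℂ (Fin (m + 1))),
      z ∈ D ↔ (z 0).re + h z < (f ‖InvariantMetrics.tail z‖₊ : ℝ)) :
    ∃ c : ℝ, 1 < c ∧ ∃ δ₀ : ℝ, 0 < δ₀ ∧ ∀ δ : ℝ, 0 < δ → δ < δ₀ →
      InvariantMetrics.basePoint m δ ∈ D ∧
      ∀ X : EuclideanSpace ℂ (Fin (m + 1)),
        ENNReal.ofReal (c⁻¹ * InvariantMetrics.modelB f δ X) ≤
            InvariantMetrics.sibonyMetric D (InvariantMetrics.basePoint m δ) X ∧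
        InvariantMetrics.sibonyMetric D (InvariantMetrics.basePoint m δ) X ≤
            InvariantMetrics.azukawaMetric D (InvariantMetrics.basePoint m δ) X ∧
        InvariantMetrics.azukawaMetric D (InvariantMetrics.basePoint m δ) X ≤
            ENNReal.ofReal (c * InvariantMetrics.modelB f δ X) := by
  simpa only [InvariantMetrics.inner_single_zero_one, InvariantMetrics.modelB,
    InvariantMetrics.neg_smul_single_eq_basePoint] using
    proposition6_general (ν := EuclideanSpace.single 0 1)
      (e := EuclideanSpace.single (Fin.last m) 1) (by simp) (by simp)
      (by simp [InvariantMetrics.inner_single_zero_one, Fin.ext_iff, Nat.ne_of_lt hm])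
      hf hf0 hfne hmono hDopen hDbdd (by simpa only [InvariantMetrics.inner_single_zero_one])
      (by simpa only [InvariantMetrics.inner_single_zero_one,
        InvariantMetrics.nnnorm_tangentialPart_single])
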